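/- Let $k\ge 1$. A $k$-graph is a countable small category $\Lambda$ with a degree functor $d:\Lambda\to\mathbb N^k$ such that whenever $d(\lambda)=m+n$ there are unique morphisms $\mu,\nu$ with $\lambda=\mu\nu$, $d(\mu)=m$, $d(\nu)=n$. Morphisms are called paths, and objects (identified with their identity morphisms) are called vertices; $\Lambda^0$ is the set of vertices, and $r(\lambda)$, $s(\lambda)$ are the codomain and the domain of $\lambda$. For a vertex $v$ and $n\in\mathbb N^k$ put $v\Lambda^n=\{\lambda : r(\lambda)=v,\ d(\lambda)=n\}$. $\Lambda$ is row-finite (source-free) if every $v\Lambda^n$ is finite (non-empty). For such a row-finite, source-free $\Lambda$, $C^*(\Lambda)$ is the universal $C^*$-algebra generated by a Cuntz–Krieger $\Lambda$-family, that is, by partial isometries $t_\lambda$ ($\lambda\in\Lambda$) such that the $t_v$ ($v\in\Lambda^0$) are mutually orthogonal projections, $t_\lambda t_\eta=t_{\lambda\eta}$ if $s(\lambda)=r(\eta)$, $t_\lambda^*t_\lambda=t_{s(\lambda)}$, and $t_v=\sum_{\lambda\in v\Lambda^n}t_\lambda t_\lambda^*$ for all $v\in\Lambda^0$ and $n\in\mathbb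 N^k$. Let $\Omega_k$ be the category with object set $\mathbb N^k$ and one morphism $(p,q)$, with range $p$, source $q$ and degree $q-p$, for each $p\le q$. An infinite path is a degree-preserving functor $x:\Omega_k\to\Lambda$; its range is $r(x)=x(0)$. Write $\vec{\imath}=(i,\dots,i)$ and, for integers $0\le i\le j$, $x_{i,j}=x(\vec{\imath},\vec{\jmath})$. Let $F_i$ be the set of all paths with source $x(\vec{\imath})$, and let $(\xi^i_\mu)_{\mu\in F_i}$ be the standard basis of $\ell^2(F_i)$. Let $\mathcal H_x$ be the inductive limit of the Hilbert spaces $\ell^2(F_i)$, $i\ge 0$, under the isometries $\xi^i_\mu\mapsto\xi^{i+1}_{\mu x_{i,i+1}}$; thus $\mathcal H_x$ has as an orthonormal basis the classes $[\xi^i_\mu]$, where, for $i\le j$, $[\xi^i_\mu]=[\xi^j_\nu]$ if and only if $\nu=\mu x_{i,j}$. **Theorem.** Let $\Lambda$ be a row-finite, source-free $k$-graph. Then every vertex $v$ is the range of some infinite path. Moreover, for every choice of infinite paths $y_v$ with $r(y_v)=v$ $(v\in\Lambda^0)$: 1. for each $v$ there is a $*$-representation $\pi_{y_v}$ of $C^*(\Lambda)$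 on $\mathcal H_{y_v}$ such that $\pi_{y_v}(t_\lambda)[\xi^i_\mu]=[\xi^i_{\lambda\mu}]$ if $s(\lambda)=r(\mu)$ and $\pi_{y_v}(t_\lambda)[\xi^i_\mu]=0$ otherwise; 2. the Hilbert space $\mathcal H=\bigoplus_{v\in\Lambda^0}\mathcal H_{y_v}$ is separable, and the direct sum $\pi=\bigoplus_{v\in\Lambda^0}\pi_{y_v}$ is a faithful $*$-representation of $C^*(\Lambda)$ on $\mathcal H$. In particular, $C^*(\Lambda)$ has a faithful representation on a separable Hilbert space. -/

import Mathlib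

open CategoryTheory
open scoped ENNReal

universe u

noncomputable section

/-- A `k`-graph: a countable small category `Λ` with a degree functor to `ℕ^k` that has the
factorization property. A morphism `f : w ⟶ v` is a path with range `v` (its codomain) and
source `w` (its domain); the path usually written `f g` (with `s(f) = r(g)`) is the composite
`f ∘ g`, that is `g ≫ f`. Vertices are the objects, identified with the identity morphisms. -/
class HigherRankGraph (k : ℕ) (Λ : Type u) [SmallCategory Λ] where
  /-- The degree of a path. -/
  degree : ∀ {w v : Λ}, (w ⟶ v) → (Fin k → ℕ)
  degree_id : ∀ v : Λ, degree (𝟙 v) = 0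
  degree_comp : ∀ {u w v : Λ} (g : u ⟶ w) (f : w ⟶ v), degree (g ≫ f) = degree f + degree g
  countable_obj : Countable Λ
  countable_hom : ∀ w v : Λ, Countable (w ⟶ v)
  /-- If `d(f) = m + n`, then `f = μ ν` for a unique pair `μ, ν` with `d(μ) = m`, `d(ν) = n`.
  The triple `⟨a, ν, μ⟩` lists the middle vertex and the two factors. -/
  factorization : ∀ {w v : Λ} (f : w ⟶ v) (m n : Fin k → ℕ), degree f = m + n →
    ∃! p : (a : Λ) × (w ⟶ a) × (a ⟶ v),
      p.2.1 ≫ p.2.2 = f ∧ degree p.2.2 = m ∧ degree p.2.1 = n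

namespace HigherRankGraph

variable (k : ℕ) (Λ : Type u) [SmallCategory Λ] [HigherRankGraph k Λ]

/-- The degree functor, with `k` explicit. -/
abbrev deg {Λ : Type u} [SmallCategory Λ] [HigherRankGraph k Λ] {w v : Λ} (f : w ⟶ v) :
    Fin k → ℕ := degree f

/-- `v Λ^n`: the paths with range `v` and degree `n`. -/
abbrev PathsTo {Λ : Type u} [SmallCategory Λ] [HigherRankGraph k Λ] (v : Λ) (n : Fin k → ℕ) :
    Type u := (w : Λ) × {f : w ⟶ v // deg k f = n}

/-- `Λ` is row-finite: every `v Λ^n` is finite. -/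
def IsRowFinite : Prop := ∀ (v : Λ) (n : Fin k → ℕ), Finite (PathsTo k v n)

/-- `Λ` is source-free: every `v Λ^n` is non-empty. -/
def IsSourceFree : Prop := ∀ (v : Λ) (n : Fin k → ℕ), Nonempty (PathsTo k v n)

/-! ### Cuntz-Krieger families and the universal algebra -/

/-- A Cuntz-Krieger `Λ`-family in a C*-algebra `A` (for row-finite `Λ`, so that the sum in `ck4`
is a finite sum). -/
structure CKFamily (A : Type*) [NonUnitalCStarAlgebra A] where
  /-- The partial isometry attached to a path. -/
  t : ∀ {w v : Λ}, (w ⟶ v) → A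
  partialIsometry : ∀ {w v : Λ} (f : w ⟶ v), t f * star (t f) * t f = t f
  ck1_star : ∀ v : Λ, star (t (𝟙 v)) = t (𝟙 v)
  ck1_idem : ∀ v : Λ, t (𝟙 v) * t (𝟙 v) = t (𝟙 v)
  ck1_orth : ∀ v w : Λ, v ≠ w → t (𝟙 v) * t (𝟙 w) = 0
  ck2 : ∀ {u w v : Λ} (g : u ⟶ w) (f : w ⟶ v), t f * t g = t (g ≫ f)
  ck3 : ∀ {w v : Λ} (f : w ⟶ v), star (t f) * t f = t (𝟙 w)
  ck4 : ∀ (v : Λ) (n : Fin k → ℕ),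
    t (𝟙 v) = ∑ᶠ p : PathsTo k v n, t p.2.1 * star (t p.2.1)

variable {k Λ} in
theorem CKFamily.norm_t_le {A : Type*} [NonUnitalCStarAlgebra A] (S : CKFamily k Λ A)
    {w v : Λ} (f : w ⟶ v) : ‖S.t f‖ ≤ 1 := by
  have h1 : ‖S.t (𝟙 w)‖ * ‖S.t (𝟙 w)‖ = ‖S.t (𝟙 w)‖ := by
    rw [← CStarRing.norm_star_mul_self, S.ck1_star, S.ck1_idem]
  have h2 : ‖S.t f‖ * ‖S.t f‖ = ‖S.t (𝟙 w)‖ := by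
    rw [← CStarRing.norm_star_mul_self, S.ck3]
  have h3 : ‖S.t (𝟙 w)‖ ≤ 1 := by nlinarith [norm_nonneg (S.t (𝟙 w))]
  nlinarith [norm_nonneg (S.t f)]

/-- A C*-algebra together with a Cuntz-Krieger `Λ`-family in it. -/
structure CKPair : Type (u + 1) where
  /-- The algebra. -/
  A : Type u
  [inst : NonUnitalCStarAlgebra A]
  /-- The family. -/
  fam : CKFamily k Λ A

attribute [instance] CKPair.inst

/-- The C*-algebra of bounded elements of the product of all Cuntz-Krieger pairs. -/
abbrev CKProduct : Type (u + 1) := lp (fun S : CKPair k Λ => S.A) ∞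

/-- The element of the product whose coordinate at a family is that family's `t f`. -/
def prodGen {Λ : Type u} [SmallCategory Λ] [HigherRankGraph k Λ] {w v : Λ} (f : w ⟶ v) :
    CKProduct k Λ :=
  ⟨fun S => S.fam.t f, memℓp_infty ⟨1, by rintro _ ⟨S, rfl⟩; exact S.fam.norm_t_le f⟩⟩

/-- The set of the generators of `C*(Λ)`. -/
def genSet : Set (CKProduct k Λ) := {a | ∃ (w v : Λ) (f : w ⟶ v), a = prodGen k f}

/-- `C*(Λ)`, the universal C*-algebra generated by a Cuntz-Krieger `Λ`-family, realised as the
C*-subalgebra generated by the diagonal family in the product of all Cuntz-Krieger families.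
The facts `universalFamily` and `existsUnique_lift` below state its universal property. -/
def cstarSubalgebra : NonUnitalStarSubalgebra ℂ (CKProduct k Λ) :=
  (NonUnitalStarAlgebra.adjoin ℂ (genSet k Λ)).topologicalClosure

/-- `C*(Λ)` as a type. -/
abbrev CStar : Type (u + 1) := cstarSubalgebra k Λ

instance : IsClosed (cstarSubalgebra k Λ : Set (CKProduct k Λ)) :=
  NonUnitalStarSubalgebra.isClosed_topologicalClosure _

instance : NonUnitalCStarAlgebra (CStar k Λ) :=
  NonUnitalStarSubalgebra.nonUnitalCStarAlgebra (cstarSubalgebra k Λ)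

/-- The canonical generator `t_f` of `C*(Λ)`. -/
def gen {Λ : Type u} [SmallCategory Λ] [HigherRankGraph k Λ] {w v : Λ} (f : w ⟶ v) :
    CStar k Λ :=
  ⟨prodGen k f, NonUnitalStarSubalgebra.le_topologicalClosure _
    (NonUnitalStarAlgebra.subset_adjoin ℂ _ ⟨w, v, f, rfl⟩)⟩

/-- The coordinate of an element of `C*(Λ)` at a Cuntz-Krieger pair, as a *-homomorphism. -/
def coord (S : CKPair k Λ) : CStar k Λ →⋆ₙₐ[ℂ] S.A where
  toFun a := (a : CKProduct k Λ) S
  map_smul' _ _ := rfl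
  map_zero' := rfl
  map_add' _ _ := rfl
  map_mul' _ _ := rfl
  map_star' _ := rfl

theorem coord_gen (S : CKPair k Λ) {w v : Λ} (f : w ⟶ v) :
    coord k Λ S (gen k f) = S.fam.t f := rfl

theorem ext_coord {a b : CStar k Λ} (h : ∀ S, coord k Λ S a = coord k Λ S b) : a = b :=
  Subtype.ext (lp.ext (funext h))

/-- The canonical generators of `C*(Λ)` form a Cuntz-Krieger `Λ`-family. -/
def universalFamily (hrow : IsRowFinite k Λ) : CKFamily k Λ (CStar k Λ) where
  t f := gen k f
  partialIsometry f := ext_coord k Λ fun S => by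
    simpa only [map_mul, map_star, coord_gen] using S.fam.partialIsometry f
  ck1_star v := ext_coord k Λ fun S => by
    simpa only [map_star, coord_gen] using S.fam.ck1_star v
  ck1_idem v := ext_coord k Λ fun S => by
    simpa only [map_mul, coord_gen] using S.fam.ck1_idem v
  ck1_orth v w h := ext_coord k Λ fun S => by
    simpa only [map_mul, map_zero, coord_gen] using S.fam.ck1_orth v w h
  ck2 g f := ext_coord k Λ fun S => by
    simpa only [map_mul, coord_gen] using S.fam.ck2 g f
  ck3 f := ext_coord k Λ fun S => by
    simpa only [map_mul, map_star, coord_gen] using S.fam.ck3 f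
  ck4 v n := ext_coord k Λ fun S => by
    have := hrow v n
    have := Fintype.ofFinite (PathsTo k v n)
    have h := S.fam.ck4 v n
    rw [finsum_eq_sum_of_fintype] at h ⊢
    simpa only [map_sum, map_mul, map_star, coord_gen] using h

/-- The universal property: a Cuntz-Krieger `Λ`-family in a C*-algebra is the image of the
canonical one under a unique *-homomorphism on `C*(Λ)`. -/
theorem existsUnique_lift (B : Type u) [NonUnitalCStarAlgebra B] (S : CKFamily k Λ B) :
    ∃! φ : CStar k Λ →⋆ₙₐ[ℂ] B, ∀ (w v : Λ) (f : w ⟶ v), φ (gen k f) = S.t f := by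
  refine ⟨coord k Λ ⟨B, S⟩, fun _ _ f => coord_gen k Λ ⟨B, S⟩ f, fun φ hφ => ?_⟩
  refine NonUnitalStarAlgHom.ext fun a => ?_
  have hc : ∀ ψ : CStar k Λ →⋆ₙₐ[ℂ] B, Continuous ψ := fun ψ =>
    AddMonoidHomClass.continuous_of_bound ψ 1 fun x => by
      simpa using NonUnitalStarAlgHom.norm_apply_le ψ x
  obtain ⟨a, ha⟩ := a
  have key : ∀ b (hb : b ∈ NonUnitalStarAlgebra.adjoin ℂ (genSet k Λ)),
      φ ⟨b, NonUnitalStarSubalgebra.le_topologicalClosure _ hb⟩ =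
        coord k Λ ⟨B, S⟩ ⟨b, NonUnitalStarSubalgebra.le_topologicalClosure _ hb⟩ := by
    intro b hb
    induction hb using NonUnitalStarAlgebra.adjoin_induction with
    | mem x hx => obtain ⟨w, v, f, rfl⟩ := hx; exact hφ w v f
    | add x y hx hy h1 h2 =>
      have h := congrArg₂ (· + ·) h1 h2
      simp only [← map_add] at h; exact h
    | zero => exact (map_zero φ).trans (map_zero _).symm
    | mul x y hx hy h1 h2 =>
      have h := congrArg₂ (· * ·) h1 h2
      simp only [← map_mul] at h; exact h
    | smul r x hx h1 =>
      have h := congrArg (r • ·) h1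
      simp only [← map_smul] at h; exact h
    | star x hx h1 =>
      have h := congrArg star h1
      simp only [← map_star] at h; exact h
  have hcl : IsClosed {a : CStar k Λ | φ a = coord k Λ ⟨B, S⟩ a} :=
    isClosed_eq (hc _) (hc _)
  have hd : (⟨a, ha⟩ : CStar k Λ) ∈ closure {a : CStar k Λ | φ a = coord k Λ ⟨B, S⟩ a} := by
    rw [closure_subtype]
    refine closure_mono ?_ ha
    intro b hb
    exact ⟨⟨b, NonUnitalStarSubalgebra.le_topologicalClosure _ hb⟩, key b hb, rfl⟩
  rw [hcl.closure_eq] at hd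
  exact hd

/-! ### Infinite paths and the inductive-limit Hilbert spaces -/

/-- The objects of the category `Ω_k`: the elements of `ℕ^k`. -/
structure Omega (k : ℕ) : Type where
  /-- The underlying element of `ℕ^k`. -/
  pt : Fin k → ℕ

/-- For `p ≤ q` in `ℕ^k`, the category `Ω_k` has one morphism `(p, q)` with range `p` and
source `q`, and no other morphisms. -/
instance omegaCategory (k : ℕ) : SmallCategory (Omega k) where
  Hom q p := PLift (p.pt ≤ q.pt)
  id p := ⟨le_rfl⟩
  comp f g := ⟨g.down.trans f.down⟩

/-- The morphism `(p, q)` of `Ω_k`. -/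
def Omega.hom {k : ℕ} {p q : Fin k → ℕ} (h : p ≤ q) : Omega.mk q ⟶ Omega.mk p := PLift.up h

/-- An infinite path: a degree-preserving functor from `Ω_k` to `Λ`, where `(p, q)` has degree
`q - p`. -/
structure InfinitePath where
  /-- The underlying functor. -/
  toFunctor : Omega k ⥤ Λ
  degree_map : ∀ {p q : Fin k → ℕ} (h : p ≤ q), deg k (toFunctor.map (Omega.hom h)) = q - p

variable {k Λ}

namespace InfinitePath

variable (x : InfinitePath k Λ)

/-- The range `x(0)` of an infinite path. -/
def range : Λ := x.toFunctor.obj ⟨0⟩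

/-- The `i`-th vertex `x(i, …, i)` on the diagonal, `i = 0, 1, 2, …`. -/
def vertex (i : ℕ) : Λ := x.toFunctor.obj ⟨fun _ => i⟩

/-- The segment `x((i, …, i), (j, …, j)) = x_i x_{i+1} ⋯ x_{j-1}`, where each `x_l` has degree
`(1, …, 1)`. -/
def seg {i j : ℕ} (h : i ≤ j) : x.vertex j ⟶ x.vertex i :=
  x.toFunctor.map (Omega.hom (show (fun _ : Fin k => i) ≤ fun _ => j from fun _ => h))

/-- `F_i`: the paths whose source is the `i`-th vertex of `x`. -/
abbrev F (i : ℕ) : Type u := (v : Λ) × (x.vertex i ⟶ v)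

/-- The map `F_i → F_j`, `μ ↦ μ x_i ⋯ x_{j-1}`. -/
def extend {i j : ℕ} (h : i ≤ j) (μ : x.F i) : x.F j := ⟨μ.1, x.seg h ≫ μ.2⟩

theorem extend_refl {i : ℕ} (μ : x.F i) : x.extend le_rfl μ = μ := by
  obtain ⟨v, μ⟩ := μ
  have : x.seg (le_refl i) = 𝟙 _ := x.toFunctor.map_id _
  simp [extend, this]

theorem extend_extend {i j l : ℕ} (h : i ≤ j) (h' : j ≤ l) (μ : x.F i) :
    x.extend h' (x.extend h μ) = x.extend (h.trans h') μ := by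
  have : x.seg h' ≫ x.seg h = x.seg (h.trans h') := (x.toFunctor.map_comp _ _).symm
  simp [extend, ← this]

theorem extend_injective {i j : ℕ} (h : i ≤ j) : Function.Injective (x.extend h) := by
  rintro ⟨v, μ⟩ ⟨v', ν⟩ he
  simp only [extend, Sigma.mk.injEq] at he
  obtain ⟨rfl, he⟩ := he
  have he := eq_of_heq he
  have hd : deg k μ = deg k ν := by
    have := congrArg (deg k) he
    simp only [deg, degree_comp] at this
    exact add_right_cancel this
  obtain ⟨p, -, hp⟩ := factorization (k := k) (x.seg h ≫ μ) (deg k μ) (deg k (x.seg h))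
    (degree_comp _ _)
  have h1 := hp ⟨_, x.seg h, μ⟩ ⟨rfl, rfl, rfl⟩
  have h2 := hp ⟨_, x.seg h, ν⟩ ⟨he.symm, hd.symm, rfl⟩
  have h3 := h1.trans h2.symm
  simp only [Sigma.mk.injEq, heq_eq_eq, true_and, Prod.mk.injEq] at h3
  rw [h3]

/-- The relation on generators: for `i ≤ j`, `ξ^i_μ ∼ ξ^j_ν` iff `ν = μ x_i ⋯ x_{j-1}`. -/
def Rel (p q : (i : ℕ) × x.F i) : Prop :=
  (∃ h : p.1 ≤ q.1, q.2 = x.extend h p.2) ∨ (∃ h : q.1 ≤ p.1, p.2 = x.extend h q.2)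

theorem rel_iff (p q : (i : ℕ) × x.F i) : x.Rel p q ↔
    ∃ (l : ℕ) (hp : p.1 ≤ l) (hq : q.1 ≤ l), x.extend hp p.2 = x.extend hq q.2 := by
  constructor
  · rintro (⟨h, e⟩ | ⟨h, e⟩)
    · exact ⟨q.1, h, le_rfl, by rw [extend_refl, e]⟩
    · exact ⟨p.1, le_rfl, h, by rw [extend_refl, e]⟩
  · rintro ⟨l, hp, hq, e⟩
    rcases le_total p.1 q.1 with h | h
    · refine Or.inl ⟨h, x.extend_injective hq ?_⟩
      rw [extend_extend, e]
    · refine Or.inr ⟨h, x.extend_injective hp ?_⟩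
      rw [extend_extend, e]

/-- `∼` is an equivalence relation on the set of all generators `ξ^i_μ`. -/
instance genSetoid : Setoid ((i : ℕ) × x.F i) where
  r := x.Rel
  iseqv :=
    { refl := fun p => Or.inl ⟨le_rfl, (x.extend_refl _).symm⟩
      symm := fun h => Or.symm h
      trans := by
        intro p q r h1 h2
        rw [rel_iff] at h1 h2 ⊢
        obtain ⟨l, hp, hq, e⟩ := h1
        obtain ⟨m, hq', hr, e'⟩ := h2
        refine ⟨max l m, hp.trans (le_max_left _ _), hr.trans (le_max_right _ _), ?_⟩
        rw [← x.extend_extend hp (le_max_left l m), e, extend_extend,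
          ← x.extend_extend hr (le_max_right l m), ← e', extend_extend] }

/-- The set of classes of generators, `(⊔ F_i)/∼`. -/
abbrev GenClass : Type u := Quotient x.genSetoid

open Classical in
/-- The standard basis vector of `ℓ²(α)` at `a`. -/
def basisVec {α : Type u} (a : α) : lp (fun _ : α => ℂ) 2 := lp.single 2 a (1 : ℂ)

/-- The Hilbert space `H_x`, the inductive limit of the spaces `ℓ²(F_i)` under the isometries
`ρ_i ξ^i_μ = ξ^{i+1}_{μ x_i}`: the Hilbert space that has the classes of generators as an
orthonormal basis. The fact `isInductiveLimit` below states that it is the inductive limit. -/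
abbrev H : Type u := lp (fun _ : x.GenClass => ℂ) 2

/-- The vector `[ξ^i_μ]` of `H_x`. -/
def ξ (i : ℕ) {v : Λ} (μ : x.vertex i ⟶ v) : x.H :=
  basisVec (Quotient.mk x.genSetoid ⟨i, ⟨v, μ⟩⟩)

open Classical in
/-- An injection of index sets induces an isometry of `ℓ²` spaces on the basis vectors. -/
theorem exists_basisIsometry {α β : Type u} (g : α → β) (hg : Function.Injective g) :
    ∃ V : lp (fun _ : α => ℂ) 2 →ₗᵢ[ℂ] lp (fun _ : β => ℂ) 2,
      ∀ a, V (basisVec a) = basisVec (g a) := by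
  have ho : Orthonormal ℂ fun a : α => basisVec (g a) := by
    rw [orthonormal_iff_ite]
    intro a b
    rw [basisVec, basisVec, lp.inner_single_left, lp.single_apply, Pi.single_apply]
    by_cases h : a = b <;> simp [h, hg.eq_iff]
  refine ⟨ho.orthogonalFamily.linearIsometry, fun a => ?_⟩
  rw [basisVec, OrthogonalFamily.linearIsometry_apply_single]
  simp

open Classical in
theorem dense_span_basisVec (α : Type u) :
    Dense (Submodule.span ℂ (Set.range (basisVec (α := α))) : Set (lp (fun _ : α => ℂ) 2)) := by
  intro f
  refine mem_closure_of_tendsto (lp.hasSum_single (by norm_num) f)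
    (Filter.Eventually.of_forall fun s => ?_)
  refine Submodule.sum_mem _ fun a _ => ?_
  have : (lp.single 2 a (f a) : lp (fun _ : α => ℂ) 2) = f a • basisVec a := by
    rw [basisVec, ← lp.single_smul]; simp
  rw [this]
  exact Submodule.smul_mem _ _ (Submodule.subset_span ⟨a, rfl⟩)

/-- `H_x` is the inductive limit of the system `(ℓ²(F_i), ρ_i)`: there are isometries
`ρ_i ξ^i_μ = ξ^{i+1}_{μ x_i}` and isometries `ι_i : ℓ²(F_i) → H_x`, `ι_i ξ^i_μ = [ξ^i_μ]`, with
`ι_{i+1} ρ_i = ι_i`, such that the increasing union of the ranges of the `ι_i` is dense. -/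
theorem isInductiveLimit :
    ∃ (ρ : ∀ i, lp (fun _ : x.F i => ℂ) 2 →ₗᵢ[ℂ] lp (fun _ : x.F (i + 1) => ℂ) 2)
      (ι : ∀ i, lp (fun _ : x.F i => ℂ) 2 →ₗᵢ[ℂ] x.H),
      (∀ i (μ : x.F i), ρ i (basisVec μ) = basisVec (x.extend (Nat.le_succ i) μ)) ∧
      (∀ i (μ : x.F i), ι i (basisVec μ) = x.ξ i μ.2) ∧
      (∀ i a, ι (i + 1) (ρ i a) = ι i a) ∧
      Dense (⋃ i, Set.range (ι i)) := by
  have hinj : ∀ i, Function.Injective fun μ : x.F i => Quotient.mk x.genSetoid ⟨i, μ⟩ := by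
    intro i μ ν h
    have h : x.Rel ⟨i, μ⟩ ⟨i, ν⟩ := Quotient.exact h
    rw [rel_iff] at h
    obtain ⟨l, hp, hq, e⟩ := h
    exact x.extend_injective hp e
  choose ρ hρ using fun i => exists_basisIsometry _ (x.extend_injective (Nat.le_succ i))
  choose ι hι using fun i => exists_basisIsometry _ (hinj i)
  have hcomp : ∀ i a, ι (i + 1) (ρ i a) = ι i a := by
    intro i a
    have : (fun a => ι (i + 1) (ρ i a)) = fun a => ι i a := by
      refine Continuous.ext_on (dense_span_basisVec (x.F i))
        ((ι (i + 1)).continuous.comp (ρ i).continuous) (ι i).continuous ?_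
      intro b hb
      refine LinearMap.eqOn_span (f := ((ι (i + 1)).comp (ρ i)).toLinearMap)
        (g := (ι i).toLinearMap) ?_ hb
      rintro _ ⟨μ, rfl⟩
      change ι (i + 1) (ρ i _) = ι i _
      rw [hρ, hι, hι]
      congr 1
      exact Quotient.sound (Or.inr ⟨Nat.le_succ i, rfl⟩)
    exact congrFun this a
  refine ⟨ρ, ι, hρ, fun i μ => hι i μ, hcomp, ?_⟩
  have hmono : Monotone fun i => LinearMap.range (ι i).toLinearMap := by
    refine monotone_nat_of_le_succ fun i => ?_
    rintro _ ⟨a, rfl⟩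
    exact ⟨ρ i a, hcomp i a⟩
  refine (dense_span_basisVec x.GenClass).mono ?_
  have hle : Submodule.span ℂ (Set.range (basisVec (α := x.GenClass))) ≤
      ⨆ i, LinearMap.range (ι i).toLinearMap := by
    rw [Submodule.span_le]
    rintro _ ⟨a, rfl⟩
    induction a using Quotient.inductionOn with
    | h p =>
      obtain ⟨i, μ⟩ := p
      exact Submodule.mem_iSup_of_mem i ⟨basisVec μ, hι i μ⟩
  intro b hb
  obtain ⟨i, hi⟩ := (Submodule.mem_iSup_of_directed _ hmono.directed_le).1 (hle hb)
  exact Set.mem_iUnion.2 ⟨i, hi⟩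

/-- `π` is the representation `π_x` on `H_x`: it maps `t_f` to the operator `T_f` with
`T_f [ξ^i_μ] = [ξ^i_{f μ}]` if `s(f) = r(μ)` and `T_f [ξ^i_μ] = 0` otherwise. Such a `π` is unique,
as the vectors `[ξ^i_μ]` span a dense subspace and the `t_f` generate `C*(Λ)`. -/
def IsPathRepresentation (π : CStar k Λ →⋆ₙₐ[ℂ] (x.H →L[ℂ] x.H)) : Prop :=
  (∀ {w v : Λ} (f : w ⟶ v) (i : ℕ) (μ : x.vertex i ⟶ w),
    π (gen k f) (x.ξ i μ) = x.ξ i (μ ≫ f)) ∧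
  (∀ {w v a : Λ} (f : w ⟶ v) (i : ℕ) (μ : x.vertex i ⟶ a), w ≠ a →
    π (gen k f) (x.ξ i μ) = 0)

end InfinitePath

/-- The Hilbert-space direct sum of the spaces `H_{y v}` over all vertices `v`. -/
abbrev SumSpace (y : Λ → InfinitePath k Λ) : Type u := lp (fun v : Λ => (y v).H) 2

end HigherRankGraph

end

/-!
Every path representation `π_{y v}` is nonzero at `t_v`, so faithfulness of their sum follows from
gauge-invariant uniqueness: a representation of `C*(Λ)` that vanishes at no `t_v` and has a
gauge-invariant kernel is injective. The kernel of `π_x` is gauge invariant because `H_x` is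
`ℤ^k`-graded, with `[ξ^i_μ]` in degree `d(μ) - (i, …, i)`, and the diagonal unitaries of this
grading implement the gauge action.

Averaging over the gauge action gives a faithful positive map of `C*(Λ)` into the closure of the
spans of the `t_μ t_ν*` with `d(μ) = d(ν) = n`, an increasing union of algebras of matrix units,
on which a representation that vanishes at no `t_v` is isometric.
-/

noncomputable section

namespace HigherRankGraph

section Factorization

variable {k : ℕ} {Λ : Type u} [SmallCategory Λ] [HigherRankGraph k Λ]

theorem deg_comp {u w v : Λ} (g : u ⟶ w) (f : w ⟶ v) :
    deg k (g ≫ f) = deg k f + deg k g := degree_comp g f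

variable (k) in
theorem sigma_eq_of_comp_eq {w a b v : Λ} {g : w ⟶ a} {f : a ⟶ v} {g' : w ⟶ b} {f' : b ⟶ v}
    (h : g ≫ f = g' ≫ f') (hd : deg k f = deg k f') :
    (⟨a, g, f⟩ : (a : Λ) × (w ⟶ a) × (a ⟶ v)) = ⟨b, g', f'⟩ := by
  have hd' : deg k g = deg k g' := by
    have hcomp := congrArg (deg k) h
    rw [deg_comp, deg_comp, hd] at hcomp
    exact add_left_cancel hcomp
  exact (factorization (g ≫ f) (deg k f) (deg k g) (deg_comp g f)).unique
    ⟨rfl, rfl, rfl⟩ ⟨h.symm, hd.symm, hd'.symm⟩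

theorem comp_right_cancel (k : ℕ) [HigherRankGraph k Λ] {w a v : Λ} {g g' : w ⟶ a} {f : a ⟶ v}
    (h : g ≫ f = g' ≫ f) : g = g' := by
  simpa using sigma_eq_of_comp_eq k h rfl

variable (k) in
theorem eq_of_degree_eq_zero {w v : Λ} (f : w ⟶ v) (h : deg k f = 0) : w = v :=
  congrArg Sigma.fst <| sigma_eq_of_comp_eq k (g := 𝟙 w) (f := f) (g' := f) (f' := 𝟙 v)
    (by simp) (h.trans (degree_id v).symm)

theorem exists_comp_eq_of_le_degree {w v : Λ} (f : w ⟶ v) {n : Fin k → ℕ} (h : n ≤ deg k f) :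
    ∃ (a : Λ) (g : w ⟶ a) (p : a ⟶ v), g ≫ p = f ∧ deg k p = n := by
  obtain ⟨⟨a, g, p⟩, ⟨hf, hp, -⟩, -⟩ :=
    factorization f n (deg k f - n) (add_tsub_cancel_of_le h).symm
  exact ⟨a, g, p, hf, hp⟩

variable (k) in
theorem exists_comp_eq_of_degree_le {w a b v : Λ} {g : w ⟶ a} {p : a ⟶ v} {h : w ⟶ b}
    {q : b ⟶ v} (hgh : g ≫ p = h ≫ q) (hpq : deg k p ≤ deg k q) : ∃ c : b ⟶ a, c ≫ p = q := by
  obtain ⟨a', c, p', rfl, hp'⟩ := exists_comp_eq_of_le_degree q hpq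
  have heq : (⟨a, g, p⟩ : (a : Λ) × (w ⟶ a) × (a ⟶ v)) = ⟨a', h ≫ c, p'⟩ :=
    sigma_eq_of_comp_eq k (by rw [hgh, Category.assoc]) hp'.symm
  cases heq
  exact ⟨c, rfl⟩

end Factorization

section InfinitePaths

variable {k : ℕ} {Λ : Type u} [SmallCategory Λ] [HigherRankGraph k Λ]

/-- `p.IsInitialSegment q`: the path `q` factors as `p` followed by another path. -/
def PathsTo.IsInitialSegment {v : Λ} {m n : Fin k → ℕ} (p : PathsTo k v m) (q : PathsTo k v n) :
    Prop := ∃ g : q.1 ⟶ p.1, g ≫ p.2.1 = q.2.1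

theorem PathsTo.IsInitialSegment.trans {v : Λ} {l m n : Fin k → ℕ} {p : PathsTo k v l}
    {q : PathsTo k v m} {r : PathsTo k v n} : p.IsInitialSegment q → q.IsInitialSegment r →
    p.IsInitialSegment r := by
  rintro ⟨g, hg⟩ ⟨h, hh⟩
  exact ⟨h ≫ g, by rw [Category.assoc, hg, hh]⟩

theorem PathsTo.IsInitialSegment.of_le {v : Λ} {l m n : Fin k → ℕ} {p : PathsTo k v l}
    {q : PathsTo k v m} {r : PathsTo k v n} : p.IsInitialSegment r → q.IsInitialSegment r →
    l ≤ m → p.IsInitialSegment q := by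
  rintro ⟨g, hg⟩ ⟨h, hh⟩ hlm
  exact exists_comp_eq_of_degree_le k (hg.trans hh.symm) (by rwa [p.2.2, q.2.2])

theorem PathsTo.exists_isInitialSegment {v : Λ} {m n : Fin k → ℕ} (q : PathsTo k v n)
    (h : m ≤ n) : ∃ p : PathsTo k v m, p.IsInitialSegment q := by
  obtain ⟨a, g, p, hg, hp⟩ := exists_comp_eq_of_le_degree q.2.1 (h.trans_eq q.2.2.symm)
  exact ⟨⟨a, p, hp⟩, g, hg⟩

theorem PathsTo.exists_extension (hsrc : IsSourceFree k Λ) {v : Λ} {n : Fin k → ℕ}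
    (p : PathsTo k v n) (m : Fin k → ℕ) : ∃ q : PathsTo k v (n + m), p.IsInitialSegment q := by
  obtain ⟨w, g, hg⟩ := hsrc p.1 m
  exact ⟨⟨w, g ≫ p.2.1, by rw [deg_comp, p.2.2, hg]⟩, g, rfl⟩

theorem exists_diagonal_paths (hsrc : IsSourceFree k Λ) (v : Λ) :
    ∃ P : ∀ i : ℕ, PathsTo k v fun _ => i,
      ∀ i j, i ≤ j → (P i).IsInitialSegment (P j) := by
  choose next hnext using fun (i : ℕ) (p : PathsTo k v fun _ => i) => p.exists_extension hsrc 1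
  let P : ∀ i : ℕ, PathsTo k v fun _ => i := Nat.rec ⟨v, 𝟙 v, degree_id v⟩ next
  refine ⟨P, fun i j hij => ?_⟩
  induction hij with
  | refl => exact ⟨𝟙 _, Category.id_comp _⟩
  | step _ ih => exact ih.trans (hnext _ _)

theorem exists_infinitePath_of_initialSegments {v : Λ} (p : ∀ n : Fin k → ℕ, PathsTo k v n)
    (hp : ∀ m n, m ≤ n → (p m).IsInitialSegment (p n)) :
    ∃ x : InfinitePath k Λ, x.range = v := by
  choose s hs using hp
  let F : Omega k ⥤ Λ :=
    { obj n := (p n.pt).1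
      map {n m} h := s m.pt n.pt h.down
      map_id n := comp_right_cancel k ((hs _ _ _).trans (Category.id_comp _).symm)
      map_comp {_ _ l} _ _ := comp_right_cancel k (f := (p l.pt).2.1)
        (by rw [hs, Category.assoc, hs, hs]) }
  refine ⟨⟨F, fun {m n} h => eq_tsub_of_add_eq ?_⟩, eq_of_degree_eq_zero k _ (p 0).2.2⟩
  have hdeg := congrArg (deg k) (hs m n h)
  rw [(p n).2.2, deg_comp, (p m).2.2, add_comm] at hdeg
  exact hdeg

theorem exists_infinitePath (hsrc : IsSourceFree k Λ) (v : Λ) :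
    ∃ x : InfinitePath k Λ, x.range = v := by
  obtain ⟨P, hP⟩ := exists_diagonal_paths hsrc v
  have hle : ∀ n : Fin k → ℕ, n ≤ fun _ => ∑ i, n i := fun n i =>
    Finset.single_le_sum (f := n) (fun _ _ => Nat.zero_le _) (Finset.mem_univ i)
  choose p hp using fun n => (P (∑ i, n i)).exists_isInitialSegment (hle n)
  refine exists_infinitePath_of_initialSegments p fun m n hmn => ?_
  exact ((hp m).trans (hP _ _ (Finset.sum_le_sum fun i _ => hmn i))).of_le (hp n) hmn

end InfinitePaths

section CStarAlgebra

variable {A : Type*} [NonUnitalCStarAlgebra A]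

theorem eq_zero_of_sum_star_mul_self_eq_zero {ι : Type*} {s : Finset ι} {a : ι → A}
    (h : ∑ i ∈ s, star (a i) * a i = 0) {i : ι} (hi : i ∈ s) : a i = 0 := by
  let _ := CStarAlgebra.spectralOrder A
  have _ := CStarAlgebra.spectralOrderedRing A
  rw [← CStarRing.star_mul_self_eq_zero_iff]
  exact (Finset.sum_eq_zero_iff_of_nonneg fun j _ => star_mul_self_nonneg (a j)).1 h i hi

theorem norm_map_of_finiteDimensional {B : Type*} [NonUnitalCStarAlgebra B] (φ : A →⋆ₙₐ[ℂ] B)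
    (D : NonUnitalStarSubalgebra ℂ A) [FiniteDimensional ℂ D.toSubmodule]
    (hinj : ∀ a ∈ D, φ a = 0 → a = 0) {a : A} (ha : a ∈ D) : ‖φ a‖ = ‖a‖ := by
  have hclosed : IsClosed (D : Set A) := D.toSubmodule.closed_of_finiteDimensional
  let _ := NonUnitalStarSubalgebra.nonUnitalCStarAlgebra D
  refine NonUnitalStarAlgHom.norm_map (φ.comp (NonUnitalStarSubalgebraClass.subtype D))
    ((injective_iff_map_eq_zero _).2 fun b hb => ?_) ⟨a, ha⟩
  exact Subtype.ext (hinj b b.2 hb)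

end CStarAlgebra

section SpanStarSubalgebra

variable {R A : Type*} [CommSemiring R] [StarRing R] [NonUnitalNonAssocSemiring A] [StarRing A]
  [Module R A] [IsScalarTower R A A] [SMulCommClass R A A] [StarModule R A]

/-- The linear span of a self-adjoint set `X`, as a *-subalgebra when it contains the products
of the elements of `X`. -/
def spanStarSubalgebra (X : Set A) (hmul : ∀ a ∈ X, ∀ b ∈ X, a * b ∈ Submodule.span R X)
    (hstar : ∀ a ∈ X, star a ∈ X) : NonUnitalStarSubalgebra R A where
  __ := Submodule.span R X
  mul_mem' ha hb :=
    LinearMap.BilinMap.apply_apply_mem_of_mem_span _ _ _ (LinearMap.mul R A) hmul _ _ ha hb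
  star_mem' {a} ha := by
    induction ha using Submodule.span_induction with
    | mem x hx => exact Submodule.subset_span (hstar x hx)
    | zero => simp
    | add x y _ _ hx hy => simpa using add_mem hx hy
    | smul c x _ hx => simpa using Submodule.smul_mem _ (star c) hx

end SpanStarSubalgebra

section CuntzKriegerFamilies

/-- The paths of a category, bundled with their source and range. -/
structure Path (Λ : Type u) [SmallCategory Λ] : Type u where
  source : Λ
  range : Λ
  hom : source ⟶ range

namespace CKFamily

variable {k : ℕ} {Λ : Type u} [SmallCategory Λ] [HigherRankGraph k Λ]
  {A : Type*} [NonUnitalCStarAlgebra A] (S : CKFamily k Λ A)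

theorem t_mul_id {w v : Λ} (f : w ⟶ v) : S.t f * S.t (𝟙 w) = S.t f := by
  rw [S.ck2, Category.id_comp]

theorem id_mul_t {w v : Λ} (f : w ⟶ v) : S.t (𝟙 v) * S.t f = S.t f := by
  rw [S.ck2, Category.comp_id]

theorem star_t_mul_id {w v : Λ} (f : w ⟶ v) : star (S.t f) * S.t (𝟙 v) = star (S.t f) := by
  rw [← S.ck1_star, ← star_mul, S.id_mul_t]

theorem id_mul_star_t {w v : Λ} (f : w ⟶ v) : S.t (𝟙 w) * star (S.t f) = star (S.t f) := by
  rw [← S.ck1_star, ← star_mul, S.t_mul_id]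

theorem mul_eq_zero_of_mul_id {v w : Λ} (h : v ≠ w) {a b : A} (ha : a * S.t (𝟙 v) = a)
    (hb : S.t (𝟙 w) * b = b) : a * b = 0 := by
  rw [← ha, ← hb, mul_assoc, ← mul_assoc (S.t (𝟙 v)), S.ck1_orth v w h, zero_mul, mul_zero]

theorem t_mul_t_of_ne {a w w' v : Λ} (f : w ⟶ v) (g : a ⟶ w') (h : w ≠ w') :
    S.t f * S.t g = 0 :=
  S.mul_eq_zero_of_mul_id h (S.t_mul_id f) (S.id_mul_t g)

theorem t_mul_star_t_of_ne {w w' v v' : Λ} (f : w ⟶ v) (g : w' ⟶ v') (h : w ≠ w') :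
    S.t f * star (S.t g) = 0 :=
  S.mul_eq_zero_of_mul_id h (S.t_mul_id f) (S.id_mul_star_t g)

theorem star_t_mul_t_of_ne {w w' v v' : Λ} (f : w ⟶ v) (g : w' ⟶ v') (h : v ≠ v') :
    star (S.t f) * S.t g = 0 :=
  S.mul_eq_zero_of_mul_id h (S.star_t_mul_id f) (S.id_mul_t g)

theorem id_eq_sum (v : Λ) (n : Fin k → ℕ) [Fintype (PathsTo k v n)] :
    S.t (𝟙 v) = ∑ p : PathsTo k v n, S.t p.2.1 * star (S.t p.2.1) := by
  rw [S.ck4 v n, finsum_eq_sum_of_fintype]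

theorem t_eq_sum {w v : Λ} (f : w ⟶ v) (n : Fin k → ℕ) [Fintype (PathsTo k w n)] :
    S.t f = ∑ a : PathsTo k w n, S.t (a.2.1 ≫ f) * star (S.t a.2.1) := by
  conv_lhs => rw [← S.t_mul_id, S.id_eq_sum w n, Finset.mul_sum]
  simp only [← mul_assoc, S.ck2]

theorem star_t_mul_t_of_pathsTo_ne (hrow : IsRowFinite k Λ) {v : Λ} {n : Fin k → ℕ}
    {p q : PathsTo k v n} (h : p ≠ q) : star (S.t p.2.1) * S.t q.2.1 = 0 := by
  classical
  have := hrow v n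
  have := Fintype.ofFinite (PathsTo k v n)
  -- Compressing `t_v = ∑ t_p t_p*` by `t_q` leaves `∑_{p ≠ q} (t_p* t_q)* (t_p* t_q) = 0`.
  have hcompress : star (S.t q.2.1) * S.t (𝟙 v) * S.t q.2.1 = S.t (𝟙 q.1) := by
    rw [S.star_t_mul_id, S.ck3]
  rw [S.id_eq_sum v n, ← Finset.add_sum_erase _ _ (Finset.mem_univ q), mul_add, add_mul,
    ← mul_assoc, S.ck3, mul_assoc, S.ck3, S.ck1_idem, add_eq_left, Finset.mul_sum,
    Finset.sum_mul] at hcompress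
  refine eq_zero_of_sum_star_mul_self_eq_zero (s := Finset.univ.erase q)
    (a := fun p : PathsTo k v n => star (S.t p.2.1) * S.t q.2.1) ?_ (by simp [h])
  simpa only [star_mul, star_star, mul_assoc] using hcompress

theorem star_t_mul_t_of_degree_eq (hrow : IsRowFinite k Λ) {p q : Path Λ}
    (hd : deg k p.hom = deg k q.hom) [Decidable (p = q)] :
    star (S.t p.hom) * S.t q.hom = if p = q then S.t (𝟙 q.source) else 0 := by
  split_ifs with h
  · rw [h, S.ck3]
  · obtain ⟨w, v, f⟩ := p
    obtain ⟨w', v', g⟩ := q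
    by_cases hv : v = v'
    · subst hv
      refine S.star_t_mul_t_of_pathsTo_ne hrow (p := ⟨w, f, hd⟩) (q := ⟨w', g, rfl⟩) fun he => h ?_
      exact congrArg (fun r : PathsTo k v (deg k g) => (⟨r.1, v, r.2.1⟩ : Path Λ)) he
    · exact S.star_t_mul_t_of_ne f g hv

/-- The elements `t_p t_q*` with `p, q ∈ E`. -/
def monomials (E : Set (Path Λ)) : Set A :=
  Set.image2 (fun p q => S.t p.hom * star (S.t q.hom)) E E

theorem star_mem_monomials {E : Set (Path Λ)} : ∀ a ∈ S.monomials E, star a ∈ S.monomials E := by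
  rintro _ ⟨p, hp, q, hq, rfl⟩
  exact ⟨q, hq, p, hp, by simp⟩

/-- The linear span of the elements `t_p t_q*` with `p, q ∈ E`. -/
def monomialSpan (E : Set (Path Λ)) : Submodule ℂ A := Submodule.span ℂ (S.monomials E)

theorem t_mul_star_t_mem_monomialSpan {E : Set (Path Λ)} {w w' v v' : Λ} {f : w ⟶ v}
    {g : w' ⟶ v'} (hf : ⟨w, v, f⟩ ∈ E) (hg : ⟨w', v', g⟩ ∈ E) :
    S.t f * star (S.t g) ∈ S.monomialSpan E :=
  Submodule.subset_span ⟨_, hf, _, hg, rfl⟩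

theorem t_mem_monomialSpan_univ {w v : Λ} (f : w ⟶ v) : S.t f ∈ S.monomialSpan Set.univ := by
  rw [← S.t_mul_id, ← S.ck1_star]
  exact S.t_mul_star_t_mem_monomialSpan (Set.mem_univ _) (Set.mem_univ _)

theorem t_mul_mul_star_t_mem {w w' v v' : Λ} (f : w ⟶ v) (g : w' ⟶ v') {a : A}
    (ha : a ∈ S.monomialSpan Set.univ) :
    S.t f * a * star (S.t g) ∈ S.monomialSpan Set.univ := by
  induction ha using Submodule.span_induction with
  | mem _ hx =>
    obtain ⟨⟨_, a, p⟩, -, ⟨_, b, q⟩, -, rfl⟩ := hx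
    rw [← mul_assoc, mul_assoc, ← star_mul]
    by_cases hw : w = a
    · by_cases hw' : w' = b
      · subst hw hw'
        rw [S.ck2, S.ck2]
        exact S.t_mul_star_t_mem_monomialSpan (Set.mem_univ _) (Set.mem_univ _)
      · simp [S.t_mul_t_of_ne g q hw']
    · simp [S.t_mul_t_of_ne f p hw]
  | zero => simp
  | add x y _ _ hx hy => simpa only [mul_add, add_mul] using add_mem hx hy
  | smul c x _ hx =>
    simpa only [mul_smul_comm, smul_mul_assoc] using Submodule.smul_mem _ c hx

theorem star_t_mul_t_mem_monomialSpan_univ (hrow : IsRowFinite k Λ) {w w' v v' : Λ}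
    (f : w ⟶ v) (g : w' ⟶ v') : star (S.t f) * S.t g ∈ S.monomialSpan Set.univ := by
  classical
  have := hrow w (deg k g)
  have := Fintype.ofFinite (PathsTo k w (deg k g))
  have := hrow w' (deg k f)
  have := Fintype.ofFinite (PathsTo k w' (deg k f))
  rw [S.t_eq_sum f (deg k g), S.t_eq_sum g (deg k f), star_sum, Finset.sum_mul_sum]
  refine Submodule.sum_mem _ fun a _ => Submodule.sum_mem _ fun b _ => ?_
  have hd : deg k (a.2.1 ≫ f) = deg k (b.2.1 ≫ g) := by
    rw [deg_comp, deg_comp, a.2.2, b.2.2, add_comm]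
  rw [star_mul, star_star, ← mul_assoc, mul_assoc (S.t a.2.1),
    S.star_t_mul_t_of_degree_eq hrow (p := ⟨_, _, a.2.1 ≫ f⟩) (q := ⟨_, _, b.2.1 ≫ g⟩) hd]
  split_ifs
  · exact S.t_mul_mul_star_t_mem _ _ (S.t_mem_monomialSpan_univ _)
  · simp

theorem mul_mem_monomialSpan_univ (hrow : IsRowFinite k Λ) :
    ∀ a ∈ S.monomials Set.univ, ∀ b ∈ S.monomials Set.univ,
      a * b ∈ S.monomialSpan Set.univ := by
  rintro _ ⟨p, -, q, -, rfl⟩ _ ⟨r, -, s, -, rfl⟩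
  rw [← mul_assoc, mul_assoc (S.t p.hom)]
  exact S.t_mul_mul_star_t_mem _ _ (S.star_t_mul_t_mem_monomialSpan_univ hrow _ _)

/-- The *-subalgebra spanned by all elements `t_p t_q*`. -/
def monomialAlgebra (hrow : IsRowFinite k Λ) : NonUnitalStarSubalgebra ℂ A :=
  spanStarSubalgebra (S.monomials Set.univ) (S.mul_mem_monomialSpan_univ hrow)
    S.star_mem_monomials

end CKFamily

end CuntzKriegerFamilies

section Core

namespace CKFamily

variable {k : ℕ} {Λ : Type u} [SmallCategory Λ] [HigherRankGraph k Λ]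
  {A : Type*} [NonUnitalCStarAlgebra A] (S : CKFamily k Λ A)

theorem mul_mem_monomialSpan (hrow : IsRowFinite k Λ) {E : Set (Path Λ)} {n : Fin k → ℕ}
    (hE : ∀ p ∈ E, deg k p.hom = n) :
    ∀ a ∈ S.monomials E, ∀ b ∈ S.monomials E, a * b ∈ S.monomialSpan E := by
  classical
  rintro _ ⟨p, hp, q, hq, rfl⟩ _ ⟨r, hr, s, hs, rfl⟩
  rw [← mul_assoc, mul_assoc (S.t p.hom),
    S.star_t_mul_t_of_degree_eq hrow ((hE q hq).trans (hE r hr).symm)]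
  split_ifs
  · by_cases hpr : p.source = r.source
    · rw [← hpr, S.t_mul_id]
      exact S.t_mul_star_t_mem_monomialSpan hp hs
    · simp [S.t_mul_t_of_ne p.hom (𝟙 r.source) hpr]
  · simp

/-- The finite-dimensional *-algebra, a sum of matrix algebras, that is spanned by the elements
`t_p t_q*` with `p, q` in a set of paths of the same degree. -/
def matrixAlgebra (hrow : IsRowFinite k Λ) {E : Set (Path Λ)} {n : Fin k → ℕ}
    (hE : ∀ p ∈ E, deg k p.hom = n) : NonUnitalStarSubalgebra ℂ A :=
  spanStarSubalgebra (S.monomials E) (S.mul_mem_monomialSpan hrow hE) S.star_mem_monomials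

theorem sum_range_mul_of_mem_monomialSpan (hrow : IsRowFinite k Λ) {E : Finset (Path Λ)}
    {n : Fin k → ℕ} (hE : ∀ p ∈ E, deg k p.hom = n) {a : A} (ha : a ∈ S.monomialSpan E) :
    (∑ p ∈ E, S.t p.hom * star (S.t p.hom)) * a = a := by
  classical
  induction ha using Submodule.span_induction with
  | mem _ hx =>
    obtain ⟨p, hp, q, -, rfl⟩ := hx
    rw [← mul_assoc, Finset.sum_mul, Finset.sum_eq_single_of_mem p hp]
    · rw [S.partialIsometry]
    · intro r hr hrp
      rw [mul_assoc, S.star_t_mul_t_of_degree_eq hrow ((hE r hr).trans (hE p hp).symm),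
        if_neg hrp, mul_zero]
  | zero => simp
  | add x y _ _ hx hy => rw [mul_add, hx, hy]
  | smul c x _ hx => rw [mul_smul_comm, hx]

theorem mul_sum_range_of_mem_monomialSpan (hrow : IsRowFinite k Λ) {E : Finset (Path Λ)}
    {n : Fin k → ℕ} (hE : ∀ p ∈ E, deg k p.hom = n) {a : A} (ha : a ∈ S.monomialSpan E) :
    a * ∑ p ∈ E, S.t p.hom * star (S.t p.hom) = a := by
  have hstar : star a ∈ S.monomialSpan E := (S.matrixAlgebra hrow hE).star_mem' ha
  simpa using congrArg star (S.sum_range_mul_of_mem_monomialSpan hrow hE hstar)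

theorem star_t_mul_mul_t_mem_span (hrow : IsRowFinite k Λ) {E : Set (Path Λ)} {n : Fin k → ℕ}
    (hE : ∀ p ∈ E, deg k p.hom = n) {p q : Path Λ} (hp : p ∈ E) (hq : q ∈ E) {a : A}
    (ha : a ∈ S.monomialSpan E) :
    star (S.t p.hom) * a * S.t q.hom ∈ Submodule.span ℂ {S.t (𝟙 q.source)} := by
  classical
  induction ha using Submodule.span_induction with
  | mem _ hx =>
    obtain ⟨r, hr, s, hs, rfl⟩ := hx
    rw [← mul_assoc, mul_assoc, S.star_t_mul_t_of_degree_eq hrow ((hE p hp).trans (hE r hr).symm),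
      S.star_t_mul_t_of_degree_eq hrow ((hE s hs).trans (hE q hq).symm)]
    by_cases hrq : r.source = q.source
    · rw [hrq, ite_mul, mul_ite, S.ck1_idem, zero_mul, mul_zero]
      split_ifs <;> simp [Submodule.mem_span_singleton_self]
    · rw [ite_mul, mul_ite, S.ck1_orth _ _ hrq]
      simp
  | zero => simp
  | add x y _ _ hx hy => simpa only [mul_add, add_mul] using add_mem hx hy
  | smul c x _ hx =>
    simpa only [mul_smul_comm, smul_mul_assoc] using Submodule.smul_mem _ c hx

theorem eq_zero_of_mem_monomialSpan (hrow : IsRowFinite k Λ) {B : Type*}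
    [NonUnitalCStarAlgebra B] (φ : A →⋆ₙₐ[ℂ] B) (hφ : ∀ v : Λ, φ (S.t (𝟙 v)) ≠ 0)
    {E : Finset (Path Λ)} {n : Fin k → ℕ} (hE : ∀ p ∈ E, deg k p.hom = n) {a : A}
    (ha : a ∈ S.monomialSpan E) (h0 : φ a = 0) : a = 0 := by
  have hcorner : ∀ p ∈ E, ∀ q ∈ E, star (S.t p.hom) * a * S.t q.hom = 0 := by
    intro p hp q hq
    obtain ⟨c, hc⟩ := Submodule.mem_span_singleton.1 (S.star_t_mul_mul_t_mem_span hrow hE hp hq ha)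
    have hφc : c • φ (S.t (𝟙 q.source)) = 0 := by
      rw [← map_smul, hc, map_mul, map_mul, h0, mul_zero, zero_mul]
    rw [← hc, (smul_eq_zero.1 hφc).resolve_right (hφ _), zero_smul]
  rw [← S.sum_range_mul_of_mem_monomialSpan hrow hE ha,
    ← S.mul_sum_range_of_mem_monomialSpan hrow hE ha, ← mul_assoc, Finset.sum_mul,
    Finset.sum_mul_sum]
  refine Finset.sum_eq_zero fun p hp => Finset.sum_eq_zero fun q hq => ?_
  rw [← mul_assoc, mul_assoc (S.t p.hom), mul_assoc (S.t p.hom), hcorner p hp q hq, mul_zero,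
    zero_mul]

theorem norm_map_of_mem_monomialSpan (hrow : IsRowFinite k Λ) {B : Type*}
    [NonUnitalCStarAlgebra B] (φ : A →⋆ₙₐ[ℂ] B) (hφ : ∀ v : Λ, φ (S.t (𝟙 v)) ≠ 0)
    {E : Finset (Path Λ)} {n : Fin k → ℕ} (hE : ∀ p ∈ E, deg k p.hom = n) {a : A}
    (ha : a ∈ S.monomialSpan E) : ‖φ a‖ = ‖a‖ := by
  have : FiniteDimensional ℂ (S.matrixAlgebra hrow hE).toSubmodule :=
    FiniteDimensional.span_of_finite ℂ (E.finite_toSet.image2 _ E.finite_toSet)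
  exact norm_map_of_finiteDimensional φ (S.matrixAlgebra hrow hE)
    (fun b hb => S.eq_zero_of_mem_monomialSpan hrow φ hφ hE hb) ha

theorem exists_finset_of_mem_monomialSpan {E : Set (Path Λ)} {a : A}
    (ha : a ∈ S.monomialSpan E) : ∃ F : Finset (Path Λ), ↑F ⊆ E ∧ a ∈ S.monomialSpan F := by
  classical
  obtain ⟨T, hTE, haT⟩ := Submodule.mem_span_finite_of_mem_span ha
  obtain ⟨F, G, hF, hG, hT⟩ := Finset.subset_set_image₂ hTE
  refine ⟨F ∪ G, by simp [hF, hG], Submodule.span_mono (fun x hx => ?_) haT⟩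
  obtain ⟨p, hp, q, hq, rfl⟩ := Finset.mem_image₂.1 (hT hx)
  exact ⟨p, Finset.mem_union_left _ hp, q, Finset.mem_union_right _ hq, rfl⟩

/-- The linear span of the elements `t_p t_q*` with `d(p) = d(q) = n`. -/
def level (n : Fin k → ℕ) : Submodule ℂ A := S.monomialSpan {p | deg k p.hom = n}

theorem level_mono (hrow : IsRowFinite k Λ) : Monotone S.level := by
  intro m n h
  refine Submodule.span_le.2 ?_
  rintro _ ⟨⟨w, v, f⟩, hf, ⟨w', v', g⟩, hg, rfl⟩
  by_cases hw : w = w'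
  · subst hw
    have := hrow w (n - m)
    have := Fintype.ofFinite (PathsTo k w (n - m))
    have hsum : S.t f * star (S.t g) =
        ∑ a : PathsTo k w (n - m), S.t (a.2.1 ≫ f) * star (S.t (a.2.1 ≫ g)) := by
      conv_lhs => rw [S.t_eq_sum f (n - m), Finset.sum_mul]
      simp only [mul_assoc, ← star_mul, S.ck2]
    have hdeg : ∀ {v : Λ} {f : w ⟶ v} (a : PathsTo k w (n - m)), deg k f = m →
        deg k (a.2.1 ≫ f) = n := fun a hf => by
      rw [deg_comp, hf, a.2.2, add_tsub_cancel_of_le h]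
    change S.t f * star (S.t g) ∈ S.level n
    rw [hsum]
    exact Submodule.sum_mem _ fun a _ => S.t_mul_star_t_mem_monomialSpan (hdeg a hf) (hdeg a hg)
  · simp [S.t_mul_star_t_of_ne f g hw]

/-- The linear span of the elements `t_p t_q*` with `d(p) = d(q)`, which is dense in the fixed
point algebra of the gauge action. -/
def core : Submodule ℂ A := ⨆ n, S.level n

theorem t_mul_star_t_mem_core {w w' v v' : Λ} {f : w ⟶ v} {g : w' ⟶ v'}
    (h : deg k f = deg k g) : S.t f * star (S.t g) ∈ S.core :=
  Submodule.mem_iSup_of_mem (deg k g) (S.t_mul_star_t_mem_monomialSpan h rfl)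

theorem norm_map_of_mem_core (hrow : IsRowFinite k Λ) {B : Type*} [NonUnitalCStarAlgebra B]
    (φ : A →⋆ₙₐ[ℂ] B) (hφ : ∀ v : Λ, φ (S.t (𝟙 v)) ≠ 0) {a : A} (ha : a ∈ S.core) :
    ‖φ a‖ = ‖a‖ := by
  obtain ⟨n, han⟩ := (Submodule.mem_iSup_of_directed _ (S.level_mono hrow).directed_le).1 ha
  obtain ⟨E, hE, haE⟩ := S.exists_finset_of_mem_monomialSpan han
  exact S.norm_map_of_mem_monomialSpan hrow φ hφ (fun p hp => hE hp) haE

end CKFamily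

end Core

section Integration

open MeasureTheory

theorem eq_zero_of_integral_star_mul_self_eq_zero {X A : Type*} [TopologicalSpace X]
    [MeasurableSpace X] [NonUnitalCStarAlgebra A] {μ : Measure X} [μ.IsOpenPosMeasure] {f : X → A}
    (hf : Continuous f) (hint : Integrable (fun x => star (f x) * f x) μ)
    (h : ∫ x, star (f x) * f x ∂μ = 0) : f = 0 := by
  let _ := CStarAlgebra.spectralOrder A
  have _ := CStarAlgebra.spectralOrderedRing A
  have hnonneg : 0 ≤ fun x => star (f x) * f x := fun x => star_mul_self_nonneg (f x)
  have hset : ∀ s, MeasurableSet s → μ s < ∞ → ∫ x in s, star (f x) * f x ∂μ = 0 :=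
    fun s _ _ => le_antisymm
      ((setIntegral_le_integral hint (.of_forall hnonneg)).trans_eq h)
      (integral_nonneg hnonneg)
  have hae := hint.ae_eq_zero_of_forall_setIntegral_eq_zero hset
  have hzero := (Continuous.ae_eq_iff_eq μ (hf.star.mul hf) continuous_zero).1 hae
  exact funext fun x => CStarRing.star_mul_self_eq_zero_iff _ |>.1 (congrFun hzero x)

variable {d : Type*} [Fintype d]

variable (d) in
/-- The normalised Haar measure of the torus. -/
abbrev torusMeasure : Measure (UnitAddTorus d) := Measure.pi fun _ => AddCircle.haarAddCircle

theorem integral_mFourier (n : d → ℤ) :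
    ∫ z, UnitAddTorus.mFourier n z ∂torusMeasure d = if n = 0 then 1 else 0 := by
  split_ifs with h
  · simp [h, UnitAddTorus.mFourier_zero]
  · obtain ⟨i, hi⟩ := Function.ne_iff.1 h
    change ∫ z : d → UnitAddCircle, ∏ i, fourier (n i) (z i) ∂torusMeasure d = 0
    rw [integral_fintype_prod_eq_prod (f := fun i (z : UnitAddCircle) => fourier (n i) z)]
    exact Finset.prod_eq_zero (Finset.mem_univ i)
      (integral_eq_zero_of_add_right_eq_neg (fourier_add_half_inv_index hi one_pos))

theorem star_mFourier_mul_self (n : d → ℤ) (z : UnitAddTorus d) :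
    star (UnitAddTorus.mFourier n z) * UnitAddTorus.mFourier n z = 1 := by
  rw [Complex.star_def, ← UnitAddTorus.mFourier_neg, ← UnitAddTorus.mFourier_add,
    neg_add_cancel, UnitAddTorus.mFourier_zero, ContinuousMap.one_apply]

theorem mFourier_mul_star_self (n : d → ℤ) (z : UnitAddTorus d) :
    UnitAddTorus.mFourier n z * star (UnitAddTorus.mFourier n z) = 1 := by
  rw [mul_comm, star_mFourier_mul_self]

theorem mFourier_apply_zero (n : d → ℤ) : UnitAddTorus.mFourier n (0 : UnitAddTorus d) = 1 := by
  simp [UnitAddTorus.mFourier]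

theorem integrable_torusMeasure {E : Type*} [NormedAddCommGroup E] {f : UnitAddTorus d → E}
    (hf : Continuous f) : Integrable f (torusMeasure d) :=
  hf.integrable_of_hasCompactSupport (HasCompactSupport.of_compactSpace f)

end Integration

theorem isClosed_setOf_continuous_apply {ι X Y : Type*} [TopologicalSpace ι] [UniformSpace X]
    [UniformSpace Y] {F : ι → X → Y} (hF : UniformEquicontinuous F) :
    IsClosed {x | Continuous fun i => F i x} :=
  (UniformFun.isClosed_setOfPred_continuous ..).preimage
    (uniformEquicontinuous_iff_uniformContinuous.1 hF).continuous

section GaugeAction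

open MeasureTheory UnitAddTorus
open scoped CStarAlgebra

/-- The *-homomorphism into the bounded elements of a product with given coordinates. -/
def lpInftyLift {ι A : Type*} {B : ι → Type*} [NonUnitalCStarAlgebra A]
    [∀ i, NonUnitalCStarAlgebra (B i)] (ρ : ∀ i, A →⋆ₙₐ[ℂ] B i) : A →⋆ₙₐ[ℂ] lp B ∞ where
  toFun a := ⟨fun i => ρ i a, memℓp_infty ⟨‖a‖, by
    rintro _ ⟨i, rfl⟩
    exact NonUnitalStarAlgHom.norm_apply_le (ρ i) a⟩⟩
  map_smul' c a := lp.ext (funext fun i => map_smul (ρ i) c a)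
  map_zero' := lp.ext (funext fun i => map_zero (ρ i))
  map_add' a b := lp.ext (funext fun i => map_add (ρ i) a b)
  map_mul' a b := lp.ext (funext fun i => map_mul (ρ i) a b)
  map_star' a := lp.ext (funext fun i => map_star (ρ i) a)

variable {k : ℕ} {Λ : Type u} [SmallCategory Λ] [HigherRankGraph k Λ]

/-- The degree of a path as an element of `ℤ^k`, the character group of the torus. -/
def zdeg (k : ℕ) {Λ : Type u} [SmallCategory Λ] [HigherRankGraph k Λ] {w v : Λ} (f : w ⟶ v) :
    Fin k → ℤ := fun i => deg k f i

theorem zdeg_id (v : Λ) : zdeg k (𝟙 v) = 0 := by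
  funext i
  simp [zdeg, deg, degree_id]

theorem zdeg_comp {a w v : Λ} (g : a ⟶ w) (f : w ⟶ v) :
    zdeg k (g ≫ f) = zdeg k f + zdeg k g := by
  funext i
  simp [zdeg, deg_comp]

theorem zdeg_eq_zdeg_iff {w v w' v' : Λ} {f : w ⟶ v} {g : w' ⟶ v'} :
    zdeg k f = zdeg k g ↔ deg k f = deg k g := by
  simp [zdeg, funext_iff]

/-- The Cuntz-Krieger family `z^{d(f)} t_f`. -/
def CKFamily.twist {A : Type*} [NonUnitalCStarAlgebra A] (S : CKFamily k Λ A)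
    (z : UnitAddTorus (Fin k)) : CKFamily k Λ A where
  t f := mFourier (zdeg k f) z • S.t f
  partialIsometry f := by
    rw [star_smul, smul_mul_smul_comm, smul_mul_smul_comm, S.partialIsometry,
      mFourier_mul_star_self, one_mul]
  ck1_star v := by simp [zdeg_id, mFourier_zero, S.ck1_star]
  ck1_idem v := by simp [zdeg_id, mFourier_zero, S.ck1_idem]
  ck1_orth v w h := by simp [zdeg_id, mFourier_zero, S.ck1_orth _ _ h]
  ck2 g f := by rw [smul_mul_smul_comm, S.ck2, zdeg_comp, mFourier_add]
  ck3 f := by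
    rw [star_smul, smul_mul_smul_comm, star_mFourier_mul_self, S.ck3, zdeg_id, mFourier_zero,
      ContinuousMap.one_apply]
  ck4 v n := by
    simpa only [zdeg_id, mFourier_zero, star_smul, smul_mul_smul_comm, mFourier_mul_star_self,
      ContinuousMap.one_apply, one_smul] using S.ck4 v n

theorem CStar.eq_top_of_gen_mem {D : NonUnitalStarSubalgebra ℂ (CStar k Λ)}
    (hcl : IsClosed (D : Set (CStar k Λ))) (hgen : ∀ {w v : Λ} (f : w ⟶ v), gen k f ∈ D) :
    D = ⊤ := by
  have hadjoin : NonUnitalStarAlgebra.adjoin ℂ (genSet k Λ) ≤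
      D.map (NonUnitalStarSubalgebraClass.subtype (cstarSubalgebra k Λ)) := by
    refine NonUnitalStarAlgebra.adjoin_le ?_
    rintro _ ⟨w, v, f, rfl⟩
    exact ⟨gen k f, hgen f, rfl⟩
  refine eq_top_iff.2 fun a _ => hcl.closure_subset ?_
  rw [closure_subtype]
  exact closure_mono hadjoin a.2

theorem mem_cstarSubalgebra_of_gen (φ : CStar k Λ →⋆ₙₐ[ℂ] CKProduct k Λ)
    (hφ : ∀ {w v : Λ} (f : w ⟶ v), φ (gen k f) ∈ cstarSubalgebra k Λ) (a : CStar k Λ) :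
    φ a ∈ cstarSubalgebra k Λ := by
  have hcl : IsClosed ((cstarSubalgebra k Λ).comap φ : Set (CStar k Λ)) :=
    (NonUnitalStarSubalgebra.isClosed_topologicalClosure _).preimage (map_continuous φ)
  have htop : (cstarSubalgebra k Λ).comap φ = ⊤ := CStar.eq_top_of_gen_mem hcl hφ
  exact (SetLike.ext_iff.1 htop a).2 trivial

variable (k Λ) in
/-- The gauge action of the torus on `C*(Λ)`, which multiplies `t_f` by `z^{d(f)}`. In the product
of all Cuntz-Krieger families it moves the coordinate at the family `z^{d(f)} t_f` to the one at
`t_f`. -/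
def gauge (z : UnitAddTorus (Fin k)) : CStar k Λ →⋆ₙₐ[ℂ] CStar k Λ :=
  NonUnitalStarAlgHom.codRestrict (lpInftyLift fun S => coord k Λ ⟨S.A, S.fam.twist z⟩)
    (cstarSubalgebra k Λ) <| mem_cstarSubalgebra_of_gen _ fun f =>
      SMulMemClass.smul_mem (mFourier (zdeg k f) z) (gen k f).2

theorem gauge_gen (z : UnitAddTorus (Fin k)) {w v : Λ} (f : w ⟶ v) :
    gauge k Λ z (gen k f) = mFourier (zdeg k f) z • gen k f := rfl

theorem gauge_monomial (z : UnitAddTorus (Fin k)) (p q : Path Λ) :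
    gauge k Λ z (gen k p.hom * star (gen k q.hom)) =
      mFourier (zdeg k p.hom - zdeg k q.hom) z • (gen k p.hom * star (gen k q.hom)) := by
  rw [map_mul, map_star, gauge_gen, gauge_gen, star_smul, smul_mul_smul_comm, sub_eq_add_neg,
    mFourier_add, mFourier_neg, Complex.star_def]

theorem CStar.topologicalClosure_monomialSpan (hrow : IsRowFinite k Λ) :
    ((universalFamily k Λ hrow).monomialSpan Set.univ).topologicalClosure = ⊤ := by
  have htop : ((universalFamily k Λ hrow).monomialAlgebra hrow).topologicalClosure = ⊤ :=
    CStar.eq_top_of_gen_mem (NonUnitalStarSubalgebra.isClosed_topologicalClosure _) fun f =>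
      NonUnitalStarSubalgebra.le_topologicalClosure _
        ((universalFamily k Λ hrow).t_mem_monomialSpan_univ f)
  exact eq_top_iff.2 fun a _ => (SetLike.ext_iff.1 htop a).2 trivial

@[elab_as_elim]
theorem CStar.induction_on (hrow : IsRowFinite k Λ) {P : CStar k Λ → Prop}
    (isClosed : IsClosed {a | P a})
    (monomial : ∀ p q : Path Λ, P (gen k p.hom * star (gen k q.hom))) (zero : P 0)
    (add : ∀ a b, P a → P b → P (a + b)) (smul : ∀ (c : ℂ) a, P a → P (c • a))
    (a : CStar k Λ) : P a := by
  refine closure_minimal (fun b hb => ?_) isClosed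
    ((SetLike.ext_iff.1 (CStar.topologicalClosure_monomialSpan hrow) a).2 trivial)
  change P b
  induction hb using Submodule.span_induction with
  | mem x hx =>
    obtain ⟨p, -, q, -, rfl⟩ := hx
    exact monomial p q
  | zero => exact zero
  | add x y _ _ hx hy => exact add x y hx hy
  | smul c x _ hx => exact smul c x hx

theorem gauge_zero (hrow : IsRowFinite k Λ) (a : CStar k Λ) : gauge k Λ 0 a = a := by
  induction a using CStar.induction_on hrow with
  | isClosed => exact isClosed_eq (map_continuous (gauge k Λ 0)) continuous_id
  | monomial p q => rw [gauge_monomial, mFourier_apply_zero, one_smul]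
  | zero => exact map_zero _
  | add a b ha hb => rw [map_add, ha, hb]
  | smul c a ha => rw [map_smul, ha]

theorem continuous_gauge (hrow : IsRowFinite k Λ) (a : CStar k Λ) :
    Continuous fun z => gauge k Λ z a := by
  induction a using CStar.induction_on hrow with
  | isClosed =>
    refine isClosed_setOf_continuous_apply
      (LipschitzWith.uniformEquicontinuous (fun z => gauge k Λ z) 1 fun z => ?_)
    exact AddMonoidHomClass.lipschitz_of_bound_nnnorm (gauge k Λ z) 1 fun a =>
      (NonUnitalStarAlgHom.norm_apply_le (gauge k Λ z) a).trans_eq (one_mul _).symm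
  | monomial p q =>
    simp only [gauge_monomial]
    fun_prop
  | zero => simp only [map_zero, continuous_const]
  | add a b ha hb => simp only [map_add]; fun_prop
  | smul c a ha => simp only [map_smul]; fun_prop

/-- The average over the gauge action, a map of `C*(Λ)` onto the closure of the core. -/
def gaugeMean (hrow : IsRowFinite k Λ) : CStar k Λ →L[ℂ] CStar k Λ :=
  LinearMap.mkContinuous
    { toFun := fun a => ∫ z, gauge k Λ z a ∂torusMeasure (Fin k)
      map_add' := fun a b => by
        simp only [map_add]
        exact integral_add (integrable_torusMeasure (continuous_gauge hrow a))
          (integrable_torusMeasure (continuous_gauge hrow b))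
      map_smul' := fun c a => by
        simp only [map_smul, RingHom.id_apply]
        exact integral_smul c _ } 1 fun a => by
    simpa using norm_integral_le_of_norm_le_const (μ := torusMeasure (Fin k))
      (.of_forall fun z => NonUnitalStarAlgHom.norm_apply_le (gauge k Λ z) a)

theorem gaugeMean_apply (hrow : IsRowFinite k Λ) (a : CStar k Λ) :
    gaugeMean hrow a = ∫ z, gauge k Λ z a ∂torusMeasure (Fin k) := rfl

theorem gaugeMean_monomial (hrow : IsRowFinite k Λ) (p q : Path Λ) :
    gaugeMean hrow (gen k p.hom * star (gen k q.hom)) =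
      if deg k p.hom = deg k q.hom then gen k p.hom * star (gen k q.hom) else 0 := by
  simp only [gaugeMean_apply, gauge_monomial]
  rw [integral_smul_const, integral_mFourier]
  simp only [sub_eq_zero, zdeg_eq_zdeg_iff, ite_smul, one_smul, zero_smul]

theorem gaugeMean_mem_core (hrow : IsRowFinite k Λ) (a : CStar k Λ) :
    gaugeMean hrow a ∈ (universalFamily k Λ hrow).core.topologicalClosure := by
  let S := universalFamily k Λ hrow
  induction a using CStar.induction_on hrow with
  | isClosed => exact S.core.isClosed_topologicalClosure.preimage (gaugeMean hrow).continuous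
  | monomial p q =>
    rw [gaugeMean_monomial]
    split_ifs with h
    · exact S.core.le_topologicalClosure (S.t_mul_star_t_mem_core h)
    · exact zero_mem _
  | zero => simp
  | add a b ha hb => simpa only [map_add] using add_mem ha hb
  | smul c a ha => simpa only [map_smul] using Submodule.smul_mem _ c ha

theorem eq_zero_of_gaugeMean_star_mul_self_eq_zero (hrow : IsRowFinite k Λ) {a : CStar k Λ}
    (h : gaugeMean hrow (star a * a) = 0) : a = 0 := by
  have hint := integrable_torusMeasure (continuous_gauge hrow (star a * a))
  simp only [gaugeMean_apply, map_mul, map_star] at h hint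
  have hzero := eq_zero_of_integral_star_mul_self_eq_zero (continuous_gauge hrow a) hint h
  simpa only [gauge_zero hrow, Pi.zero_apply] using congrFun hzero 0

theorem gaugeMean_map_eq_zero (hrow : IsRowFinite k Λ) {B : Type*} [NonUnitalCStarAlgebra B]
    (φ : CStar k Λ →⋆ₙₐ[ℂ] B) {a : CStar k Λ} (ha : ∀ z, φ (gauge k Λ z a) = 0) :
    φ (gaugeMean hrow a) = 0 := by
  let L : CStar k Λ →L[ℂ] B := ⟨(φ : CStar k Λ →ₗ[ℂ] B), map_continuous φ⟩
  change L (∫ z, gauge k Λ z a ∂torusMeasure (Fin k)) = 0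
  rw [← L.integral_comp_comm (integrable_torusMeasure (continuous_gauge hrow a))]
  exact (integral_congr_ae (.of_forall ha)).trans (integral_zero _ _)

theorem gaugeInvariant_uniqueness (hrow : IsRowFinite k Λ) {B : Type*} [NonUnitalCStarAlgebra B]
    (φ : CStar k Λ →⋆ₙₐ[ℂ] B) (hφ : ∀ v : Λ, φ (gen k (𝟙 v)) ≠ 0)
    (hker : ∀ z a, φ a = 0 → φ (gauge k Λ z a) = 0) : Function.Injective φ := by
  refine (injective_iff_map_eq_zero φ).2 fun a ha => ?_
  have hiso : ∀ b ∈ (universalFamily k Λ hrow).core.topologicalClosure, ‖φ b‖ = ‖b‖ :=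
    closure_minimal (fun b hb => (universalFamily k Λ hrow).norm_map_of_mem_core hrow φ hφ hb)
      (isClosed_eq (map_continuous φ).norm continuous_norm)
  have hmean : φ (gaugeMean hrow (star a * a)) = 0 :=
    gaugeMean_map_eq_zero hrow φ fun z => hker z _ (by rw [map_mul, ha, mul_zero])
  refine eq_zero_of_gaugeMean_star_mul_self_eq_zero hrow (norm_eq_zero.1 ?_)
  rw [← hiso _ (gaugeMean_mem_core hrow _), hmean, norm_zero]

end GaugeAction

section HilbertSums

theorem separableSpace_lp {ι : Type*} [Countable ι] {E : ι → Type*}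
    [∀ i, NormedAddCommGroup (E i)] [∀ i, NormedSpace ℂ (E i)]
    [∀ i, TopologicalSpace.SeparableSpace (E i)] {p : ℝ≥0∞} [Fact (1 ≤ p)] (hp : p ≠ ∞) :
    TopologicalSpace.SeparableSpace (lp E p) := by
  classical
  have hsingle : TopologicalSpace.IsSeparable (⋃ i, Set.range (lp.single (E := E) p i)) :=
    .iUnion fun i => TopologicalSpace.isSeparable_range (lp.isometry_single i).continuous
  refine TopologicalSpace.isSeparable_univ_iff.1 ((hsingle.span (R := ℂ)).closure.mono
    fun f _ => mem_closure_of_tendsto (lp.hasSum_single hp f) (.of_forall fun s => ?_))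
  exact Submodule.sum_mem _ fun i _ => Submodule.subset_span (Set.mem_iUnion.2 ⟨i, f i, rfl⟩)

variable {ι : Type*} {E : ι → Type*} [∀ i, NormedAddCommGroup (E i)]
  [∀ i, InnerProductSpace ℂ (E i)] [∀ i, CompleteSpace (E i)]

/-- The direct sum of a family of representations of a C*-algebra. -/
def directSum {A : Type*} [NonUnitalCStarAlgebra A] (ρ : ∀ i, A →⋆ₙₐ[ℂ] (E i →L[ℂ] E i)) :
    A →⋆ₙₐ[ℂ] (lp E 2 →L[ℂ] lp E 2) where
  toFun a := lp.mapCLM 2 (fun i => ρ i a) (norm_nonneg a)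
    fun i => NonUnitalStarAlgHom.norm_apply_le (ρ i) a
  map_smul' c a := by ext h i; exact congrArg (· (h i)) (map_smul (ρ i) c a)
  map_zero' := by ext h i; exact congrArg (· (h i)) (map_zero (ρ i))
  map_add' a b := by ext h i; exact congrArg (· (h i)) (map_add (ρ i) a b)
  map_mul' a b := by ext h i; exact congrArg (· (h i)) (map_mul (ρ i) a b)
  map_star' a := by
    refine (ContinuousLinearMap.eq_adjoint_iff _ _).2 fun g h => ?_
    rw [lp.inner_eq_tsum, lp.inner_eq_tsum]
    refine tsum_congr fun i => ?_
    change inner ℂ (ρ i (star a) (g i)) (h i) = inner ℂ (g i) (ρ i a (h i))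
    rw [map_star, ContinuousLinearMap.star_eq_adjoint, ContinuousLinearMap.adjoint_inner_left]

theorem directSum_apply {A : Type*} [NonUnitalCStarAlgebra A]
    (ρ : ∀ i, A →⋆ₙₐ[ℂ] (E i →L[ℂ] E i)) (a : A) (h : lp E 2) (i : ι) :
    directSum ρ a h i = ρ i a (h i) := rfl

theorem directSum_eq_zero_iff {A : Type*} [NonUnitalCStarAlgebra A]
    {ρ : ∀ i, A →⋆ₙₐ[ℂ] (E i →L[ℂ] E i)} {a : A} : directSum ρ a = 0 ↔ ∀ i, ρ i a = 0 := by
  classical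
  constructor
  · intro h i
    ext e
    have happly := congrArg (fun T : lp E 2 →L[ℂ] lp E 2 => T (lp.single 2 i e) i) h
    simp only [directSum_apply, lp.single_apply_self] at happly
    exact happly
  · intro h
    ext e i
    rw [directSum_apply, h]
    rfl

end HilbertSums

section BasisIsometries

variable {α β γ : Type u}

/-- The Hilbert space `ℓ²(α)`. -/
abbrev EllTwo (α : Type u) : Type u := lp (fun _ : α => ℂ) 2

open InfinitePath (basisVec exists_basisIsometry dense_span_basisVec)

theorem basisVec_apply [DecidableEq α] (a b : α) :
    basisVec a b = if a = b then (1 : ℂ) else 0 := by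
  by_cases h : a = b
  · subst h
    simp [basisVec]
  · simp [basisVec, h, Ne.symm h]

theorem basisVec_ne_zero (a : α) : basisVec a ≠ 0 := by
  classical
  intro h
  simpa [basisVec_apply] using congrArg (fun v : EllTwo α => v a) h

theorem ext_basisVec {F : Type*} [NormedAddCommGroup F] [NormedSpace ℂ F]
    {S T : EllTwo α →L[ℂ] F} (h : ∀ a, S (basisVec a) = T (basisVec a)) : S = T := by
  refine ContinuousLinearMap.ext_on (dense_span_basisVec α) ?_
  rintro _ ⟨a, rfl⟩
  exact h a

/-- The isometry `ℓ²(α) → ℓ²(β)` that an injection `α → β` induces on the standard bases. -/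
def basisIsometry (g : α ↪ β) : EllTwo α →L[ℂ] EllTwo β :=
  (exists_basisIsometry g g.injective).choose.toContinuousLinearMap

theorem basisIsometry_basisVec (g : α ↪ β) (a : α) :
    basisIsometry g (basisVec a) = basisVec (g a) :=
  (exists_basisIsometry g g.injective).choose_spec a

theorem adjoint_basisIsometry_apply (g : α ↪ β) (h : EllTwo β) (a : α) :
    (basisIsometry g).adjoint h a = h (g a) := by
  classical
  have hinner := (basisIsometry g).adjoint_inner_right (basisVec a) h
  rw [basisIsometry_basisVec] at hinner
  simpa [basisVec, lp.inner_single_left] using hinner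

theorem adjoint_basisIsometry_basisVec (g : α ↪ β) (a : α) :
    (basisIsometry g).adjoint (basisVec (g a)) = basisVec a := by
  classical
  ext b
  rw [adjoint_basisIsometry_apply, basisVec_apply, basisVec_apply]
  exact if_congr g.injective.eq_iff rfl rfl

theorem adjoint_basisIsometry_basisVec_of_notMem (g : α ↪ β) {b : β} (h : b ∉ Set.range g) :
    (basisIsometry g).adjoint (basisVec b) = 0 := by
  classical
  ext a
  rw [adjoint_basisIsometry_apply, basisVec_apply, if_neg fun hb => h ⟨a, hb.symm⟩]
  rfl

theorem basisIsometry_refl : basisIsometry (.refl α) = .id ℂ _ :=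
  ext_basisVec fun a => basisIsometry_basisVec _ a

theorem basisIsometry_trans (g : α ↪ β) (h : β ↪ γ) :
    basisIsometry (g.trans h) = basisIsometry h ∘L basisIsometry g :=
  ext_basisVec fun a => by simp [basisIsometry_basisVec]

theorem adjoint_basisIsometry_basisIsometry (g : α ↪ β) (h : EllTwo α) :
    (basisIsometry g).adjoint (basisIsometry g h) = h :=
  DFunLike.congr_fun (ext_basisVec (T := .id ℂ _) fun a => by
    simp [basisIsometry_basisVec, adjoint_basisIsometry_basisVec] :
      (basisIsometry g).adjoint ∘L basisIsometry g = .id ℂ _) h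

theorem adjoint_basisIsometry_basisIsometry_of_disjoint {g : α ↪ γ} {h : β ↪ γ}
    (hgh : Disjoint (Set.range g) (Set.range h)) (e : EllTwo β) :
    (basisIsometry g).adjoint (basisIsometry h e) = 0 :=
  DFunLike.congr_fun (ext_basisVec (T := 0) fun b => by
    simpa [basisIsometry_basisVec] using
      adjoint_basisIsometry_basisVec_of_notMem g (Set.disjoint_right.1 hgh ⟨b, rfl⟩) :
      (basisIsometry g).adjoint ∘L basisIsometry h = 0) e

theorem sum_basisIsometry_comp_adjoint {ι : Type*} [Fintype ι] {α : ι → Type u}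
    (g : ∀ i, α i ↪ β) (hg : Function.Bijective fun p : (i : ι) × α i => g p.1 p.2) :
    ∑ i, basisIsometry (g i) ∘L (basisIsometry (g i)).adjoint = .id ℂ _ := by
  refine ext_basisVec fun b => ?_
  obtain ⟨⟨i, a⟩, rfl⟩ := hg.surjective b
  simp only [sum_apply, ContinuousLinearMap.comp_apply,
    ContinuousLinearMap.id_apply]
  rw [Finset.sum_eq_single i, adjoint_basisIsometry_basisVec, basisIsometry_basisVec]
  · intro j _ hji
    rw [adjoint_basisIsometry_basisVec_of_notMem, map_zero]
    rintro ⟨c, hc⟩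
    exact hji (congrArg Sigma.fst (hg.injective (a₁ := ⟨j, c⟩) (a₂ := ⟨i, a⟩) hc))
  · exact fun h => absurd (Finset.mem_univ i) h

/-- The operator on `ℓ²(α)` that multiplies the basis vector at `a` by `u a`. -/
def diagonal (u : α → unitary ℂ) : EllTwo α →L[ℂ] EllTwo α :=
  lp.mapCLM 2 (fun a => (u a : ℂ) • .id ℂ ℂ) zero_le_one fun a => by simp [norm_smul]

theorem star_diagonal (u : α → unitary ℂ) : star (diagonal u) = diagonal u⁻¹ := by
  refine ((ContinuousLinearMap.eq_adjoint_iff _ _).2 fun g h => ?_).symm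
  rw [lp.inner_eq_tsum, lp.inner_eq_tsum]
  refine tsum_congr fun a => ?_
  change inner ℂ (star (u a : ℂ) * g a) (h a) = inner ℂ (g a) ((u a : ℂ) * h a)
  simp only [RCLike.inner_apply, map_mul, RCLike.star_def, Complex.conj_conj]
  ring

theorem diagonal_mul (u v : α → unitary ℂ) : diagonal u * diagonal v = diagonal (u * v) := by
  ext h a
  exact (mul_assoc (u a : ℂ) (v a) (h a)).symm

theorem diagonal_one : diagonal (1 : α → unitary ℂ) = 1 := by
  ext h a
  exact one_mul (h a)

/-- The unitary operator on `ℓ²(α)` that multiplies the basis vector at `a` by `u a`. -/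
def diagonalUnitary (u : α → unitary ℂ) : unitary (EllTwo α →L[ℂ] EllTwo α) :=
  ⟨diagonal u, by rw [star_diagonal, diagonal_mul, inv_mul_cancel, diagonal_one],
    by rw [star_diagonal, diagonal_mul, mul_inv_cancel, diagonal_one]⟩

theorem diagonalUnitary_basisVec (u : α → unitary ℂ) (a : α) :
    (diagonalUnitary u : EllTwo α →L[ℂ] EllTwo α) (basisVec a) = (u a : ℂ) • basisVec a := by
  classical
  ext b
  change (u b : ℂ) * basisVec a b = (u a : ℂ) * basisVec a b
  rw [basisVec_apply]
  split_ifs with h <;> simp [h]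

end BasisIsometries

section PathRepresentations

open UnitAddTorus

variable {k : ℕ} {Λ : Type u} [SmallCategory Λ] [HigherRankGraph k Λ]

namespace InfinitePath

variable (x : InfinitePath k Λ)

theorem countable_genClass : Countable x.GenClass := by
  have := countable_obj k (Λ := Λ)
  have := countable_hom k (Λ := Λ)
  infer_instance

theorem deg_seg {i j : ℕ} (h : i ≤ j) : deg k (x.seg h) = fun _ => j - i := x.degree_map _

/-- The classes of generators whose range is `v`. -/
def ClassTo (v : Λ) : Type u :=
  Quotient (x.genSetoid.comap fun p : (i : ℕ) × (x.vertex i ⟶ v) => ⟨p.1, v, p.2⟩)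

/-- The class with range `v` of the generator `ξ^i_μ`. -/
def classTo {v : Λ} (i : ℕ) (μ : x.vertex i ⟶ v) : x.ClassTo v := Quotient.mk _ ⟨i, μ⟩

variable {x}

theorem ClassTo.exists_rep {v : Λ} (c : x.ClassTo v) :
    ∃ (i : ℕ) (μ : x.vertex i ⟶ v), x.classTo i μ = c := by
  obtain ⟨⟨i, μ⟩, rfl⟩ := Quotient.exists_rep c
  exact ⟨i, μ, rfl⟩

theorem classTo_eq_iff {v : Λ} {i j : ℕ} {μ : x.vertex i ⟶ v} {ν : x.vertex j ⟶ v} :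
    x.classTo i μ = x.classTo j ν ↔
      ∃ (l : ℕ) (hi : i ≤ l) (hj : j ≤ l), x.seg hi ≫ μ = x.seg hj ≫ ν :=
  Quotient.eq.trans <| (x.rel_iff _ _).trans <| by simp [extend]

theorem classTo_seg {v : Λ} {i j : ℕ} (h : i ≤ j) (μ : x.vertex i ⟶ v) :
    x.classTo j (x.seg h ≫ μ) = x.classTo i μ :=
  Quotient.sound (Or.inr ⟨h, rfl⟩)

variable (x)

/-- The inclusion of the classes with range `v` into all classes. -/
def classInclusion (v : Λ) : x.ClassTo v ↪ x.GenClass where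
  toFun := Quotient.map (fun p => ⟨p.1, v, p.2⟩) fun _ _ h => h
  inj' := by
    rintro ⟨p⟩ ⟨q⟩ h
    exact Quotient.sound (Quotient.exact (s := x.genSetoid) h)

theorem classInclusion_classTo {v : Λ} {i : ℕ} (μ : x.vertex i ⟶ v) :
    basisVec (x.classInclusion v (x.classTo i μ)) = x.ξ i μ := rfl

theorem disjoint_range_classInclusion {v w : Λ} (h : v ≠ w) :
    Disjoint (Set.range (x.classInclusion v)) (Set.range (x.classInclusion w)) := by
  rw [Set.disjoint_range_iff]
  rintro ⟨p⟩ ⟨q⟩ hpq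
  obtain ⟨l, hp, hq, heq⟩ := (x.rel_iff _ _).1 (Quotient.exact hpq)
  exact h (congrArg Sigma.fst heq)

/-- The action `[μ] ↦ [f μ]` of a path `f` on classes. -/
def translate {w v : Λ} (f : w ⟶ v) : x.ClassTo w ↪ x.ClassTo v where
  toFun := Quotient.map (fun p => ⟨p.1, p.2 ≫ f⟩) <| by
    rintro ⟨i, μ⟩ ⟨j, ν⟩ h
    obtain ⟨l, hi, hj, heq⟩ := classTo_eq_iff.1 (Quotient.sound h)
    refine Quotient.exact (classTo_eq_iff.2 ⟨l, hi, hj, ?_⟩)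
    rw [← Category.assoc, heq, Category.assoc]
  inj' c d h := by
    obtain ⟨i, μ, rfl⟩ := c.exists_rep
    obtain ⟨j, ν, rfl⟩ := d.exists_rep
    obtain ⟨l, hi, hj, heq⟩ := classTo_eq_iff.1 h
    refine classTo_eq_iff.2 ⟨l, hi, hj, comp_right_cancel k (f := f) ?_⟩
    rw [Category.assoc, heq, Category.assoc]

theorem translate_classTo {w v : Λ} (f : w ⟶ v) {i : ℕ} (μ : x.vertex i ⟶ w) :
    x.translate f (x.classTo i μ) = x.classTo i (μ ≫ f) := rfl

theorem translate_id (v : Λ) : x.translate (𝟙 v) = .refl _ := by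
  ext c
  obtain ⟨i, μ, rfl⟩ := c.exists_rep
  rw [translate_classTo, Category.comp_id]
  rfl

theorem translate_comp {u w v : Λ} (g : u ⟶ w) (f : w ⟶ v) :
    x.translate (g ≫ f) = (x.translate g).trans (x.translate f) := by
  ext c
  obtain ⟨i, μ, rfl⟩ := c.exists_rep
  exact congrArg (x.classTo i) (Category.assoc μ g f).symm

theorem translate_pathsTo_injective (v : Λ) (n : Fin k → ℕ) :
    Function.Injective fun c : (p : PathsTo k v n) × x.ClassTo p.1 =>
      x.translate c.1.2.1 c.2 := by
  rintro ⟨⟨a, p, hp⟩, c⟩ ⟨⟨b, q, hq⟩, d⟩ h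
  obtain ⟨i, μ, rfl⟩ := c.exists_rep
  obtain ⟨j, ν, rfl⟩ := d.exists_rep
  obtain ⟨l, hi, hj, heq⟩ := classTo_eq_iff.1 h
  rw [← Category.assoc, ← Category.assoc] at heq
  have hpq := sigma_eq_of_comp_eq k heq (hp.trans hq.symm)
  obtain rfl : a = b := congrArg Sigma.fst hpq
  simp only [Sigma.mk.injEq, heq_eq_eq, true_and, Prod.mk.injEq] at hpq
  obtain rfl := hpq.2
  simpa using (x.translate p).injective h

theorem translate_pathsTo_surjective (v : Λ) (n : Fin k → ℕ) :
    Function.Surjective fun c : (p : PathsTo k v n) × x.ClassTo p.1 =>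
      x.translate c.1.2.1 c.2 := by
  intro c
  obtain ⟨i, μ, rfl⟩ := c.exists_rep
  have hi : i ≤ i + ∑ l, n l := Nat.le_add_right _ _
  have hn : n ≤ deg k (x.seg hi ≫ μ) := fun l => by
    have hl := Finset.single_le_sum (f := n) (fun _ _ => Nat.zero_le _) (Finset.mem_univ l)
    rw [deg_comp, x.deg_seg]
    exact le_add_left (hl.trans_eq (Nat.add_sub_cancel_left i _).symm)
  obtain ⟨a, g, p, hgp, hp⟩ := exists_comp_eq_of_le_degree _ hn
  exact ⟨⟨⟨a, p, hp⟩, x.classTo _ g⟩, by simp only [translate_classTo, hgp, classTo_seg]⟩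

/-- The operator `T_f` on `H_x`: project onto the span of the `[ξ^i_μ]` with `r(μ) = s(f)`, then
map `[ξ^i_μ]` to `[ξ^i_{f μ}]`. -/
def pathOperator {w v : Λ} (f : w ⟶ v) : x.H →L[ℂ] x.H :=
  basisIsometry (x.classInclusion v) ∘L basisIsometry (x.translate f) ∘L
    (basisIsometry (x.classInclusion w)).adjoint

theorem pathOperator_apply {w v : Λ} (f : w ⟶ v) (h : x.H) :
    x.pathOperator f h = basisIsometry (x.classInclusion v)
      (basisIsometry (x.translate f) ((basisIsometry (x.classInclusion w)).adjoint h)) := rfl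

theorem pathOperator_id_apply (v : Λ) (h : x.H) :
    x.pathOperator (𝟙 v) h =
      basisIsometry (x.classInclusion v) ((basisIsometry (x.classInclusion v)).adjoint h) := by
  simp [pathOperator, translate_id, basisIsometry_refl]

theorem star_pathOperator_apply {w v : Λ} (f : w ⟶ v) (h : x.H) :
    star (x.pathOperator f) h = basisIsometry (x.classInclusion w)
      ((basisIsometry (x.translate f)).adjoint
        ((basisIsometry (x.classInclusion v)).adjoint h)) := by
  simp [pathOperator, ContinuousLinearMap.star_eq_adjoint, ContinuousLinearMap.adjoint_comp]

theorem pathOperator_mul_pathOperator {u w v : Λ} (g : u ⟶ w) (f : w ⟶ v) :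
    x.pathOperator f * x.pathOperator g = x.pathOperator (g ≫ f) := by
  ext1 h
  simp [pathOperator, translate_comp, basisIsometry_trans, adjoint_basisIsometry_basisIsometry]

theorem star_pathOperator_mul_self {w v : Λ} (f : w ⟶ v) :
    star (x.pathOperator f) * x.pathOperator f = x.pathOperator (𝟙 w) := by
  ext1 h
  rw [mul_apply_eq_comp, star_pathOperator_apply, pathOperator_id_apply,
    pathOperator_apply, adjoint_basisIsometry_basisIsometry, adjoint_basisIsometry_basisIsometry]

theorem sum_pathOperator_mul_star (v : Λ) (n : Fin k → ℕ) [Fintype (PathsTo k v n)] :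
    ∑ p : PathsTo k v n, x.pathOperator p.2.1 * star (x.pathOperator p.2.1) =
      x.pathOperator (𝟙 v) := by
  ext1 h
  have hsum := sum_basisIsometry_comp_adjoint (fun p : PathsTo k v n => x.translate p.2.1)
    ⟨x.translate_pathsTo_injective v n, x.translate_pathsTo_surjective v n⟩
  have happly := DFunLike.congr_fun hsum ((basisIsometry (x.classInclusion v)).adjoint h)
  simp only [sum_apply, ContinuousLinearMap.comp_apply, ContinuousLinearMap.id_apply] at happly
  rw [pathOperator_id_apply, sum_apply]
  simp only [mul_apply_eq_comp, star_pathOperator_apply, pathOperator_apply,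
    adjoint_basisIsometry_basisIsometry, ← map_sum, happly]

/-- The Cuntz-Krieger family of the operators `T_f` on `H_x`. -/
def pathFamily (hrow : IsRowFinite k Λ) : CKFamily k Λ (x.H →L[ℂ] x.H) where
  t f := x.pathOperator f
  partialIsometry f := by
    rw [mul_assoc, star_pathOperator_mul_self, pathOperator_mul_pathOperator, Category.id_comp]
  ck1_star v := by
    have hstar := x.star_pathOperator_mul_self (𝟙 v)
    rw [← hstar, star_mul, star_star]
  ck1_idem v := by rw [pathOperator_mul_pathOperator, Category.id_comp]
  ck1_orth v w h := by
    ext1 e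
    simp [pathOperator_id_apply,
      adjoint_basisIsometry_basisIsometry_of_disjoint (x.disjoint_range_classInclusion h)]
  ck2 g f := x.pathOperator_mul_pathOperator g f
  ck3 f := x.star_pathOperator_mul_self f
  ck4 v n := by
    have := hrow v n
    have := Fintype.ofFinite (PathsTo k v n)
    rw [finsum_eq_sum_of_fintype, sum_pathOperator_mul_star]

/-- The representation `π_x` of `C*(Λ)` on `H_x`. -/
def pathRepresentation (hrow : IsRowFinite k Λ) : CStar k Λ →⋆ₙₐ[ℂ] (x.H →L[ℂ] x.H) :=
  coord k Λ ⟨x.H →L[ℂ] x.H, x.pathFamily hrow⟩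

theorem pathRepresentation_gen (hrow : IsRowFinite k Λ) {w v : Λ} (f : w ⟶ v) :
    x.pathRepresentation hrow (gen k f) = x.pathOperator f := rfl

theorem pathOperator_ξ {w v : Λ} (f : w ⟶ v) (i : ℕ) (μ : x.vertex i ⟶ w) :
    x.pathOperator f (x.ξ i μ) = x.ξ i (μ ≫ f) := by
  simp [← classInclusion_classTo, pathOperator, adjoint_basisIsometry_basisVec,
    basisIsometry_basisVec, translate_classTo]

theorem pathOperator_ξ_of_ne {w v a : Λ} (f : w ⟶ v) (i : ℕ) (μ : x.vertex i ⟶ a) (h : w ≠ a) :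
    x.pathOperator f (x.ξ i μ) = 0 := by
  have hnot : x.classInclusion a (x.classTo i μ) ∉ Set.range (x.classInclusion w) :=
    Set.disjoint_right.1 (x.disjoint_range_classInclusion h) ⟨_, rfl⟩
  simp [← classInclusion_classTo, pathOperator, adjoint_basisIsometry_basisVec_of_notMem _ hnot]

theorem isPathRepresentation_pathRepresentation (hrow : IsRowFinite k Λ) :
    x.IsPathRepresentation (x.pathRepresentation hrow) :=
  ⟨x.pathOperator_ξ, x.pathOperator_ξ_of_ne⟩

theorem pathRepresentation_range_ne_zero (hrow : IsRowFinite k Λ) :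
    x.pathRepresentation hrow (gen k (𝟙 x.range)) ≠ 0 := fun h => by
  have hξ := x.pathOperator_ξ (𝟙 x.range) 0 (𝟙 (x.vertex 0))
  rw [← x.pathRepresentation_gen hrow, h] at hξ
  exact basisVec_ne_zero _ hξ.symm

/-- The degree `d(μ) - (i, …, i)` of the class of `ξ^i_μ`, in `ℤ^k`. -/
def classDegree : x.GenClass → Fin k → ℤ :=
  Quotient.lift (fun p => zdeg k p.2.2 - fun _ => (p.1 : ℤ)) <| by
    have hextend {i j : ℕ} (h : i ≤ j) (μ : x.F i) :
        (zdeg k (x.extend h μ).2 - fun _ => (j : ℤ)) = zdeg k μ.2 - fun _ => (i : ℤ) := by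
      funext l
      simp only [extend, zdeg_comp, Pi.sub_apply, Pi.add_apply]
      simp only [zdeg, deg_seg, Nat.cast_sub h]
      ring
    rintro ⟨i, μ⟩ ⟨j, ν⟩ (⟨h, hν⟩ | ⟨h, hμ⟩)
    · dsimp only at h hν
      subst hν
      exact (hextend h μ).symm
    · dsimp only at h hμ
      subst hμ
      exact hextend h ν

/-- The unitary operator on `H_x` that implements the gauge automorphism `γ_z`. -/
def gaugeUnitary (z : UnitAddTorus (Fin k)) : unitary (x.H →L[ℂ] x.H) :=
  diagonalUnitary fun c => ⟨mFourier (x.classDegree c) z,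
    star_mFourier_mul_self _ _, mFourier_mul_star_self _ _⟩

theorem gaugeUnitary_ξ (z : UnitAddTorus (Fin k)) (i : ℕ) {v : Λ} (μ : x.vertex i ⟶ v) :
    (x.gaugeUnitary z : x.H →L[ℂ] x.H) (x.ξ i μ) =
      mFourier (zdeg k μ - fun _ => (i : ℤ)) z • x.ξ i μ :=
  diagonalUnitary_basisVec _ _

theorem gaugeUnitary_mul_pathOperator (z : UnitAddTorus (Fin k)) {w v : Λ} (f : w ⟶ v) :
    (x.gaugeUnitary z : x.H →L[ℂ] x.H) * x.pathOperator f =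
      (mFourier (zdeg k f) z • x.pathOperator f) * x.gaugeUnitary z := by
  refine ext_basisVec fun c => ?_
  obtain ⟨⟨i, a, μ⟩, rfl⟩ := Quotient.exists_rep c
  change (x.gaugeUnitary z : x.H →L[ℂ] x.H) (x.pathOperator f (x.ξ i μ)) =
    mFourier (zdeg k f) z • x.pathOperator f ((x.gaugeUnitary z : x.H →L[ℂ] x.H) (x.ξ i μ))
  rw [gaugeUnitary_ξ, map_smul]
  by_cases h : w = a
  · subst h
    rw [pathOperator_ξ, gaugeUnitary_ξ, smul_smul, ← mFourier_add, zdeg_comp, add_sub_assoc]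
  · rw [pathOperator_ξ_of_ne _ _ _ _ h, map_zero, smul_zero, smul_zero]

theorem pathRepresentation_gauge (hrow : IsRowFinite k Λ) (z : UnitAddTorus (Fin k))
    (a : CStar k Λ) :
    x.pathRepresentation hrow (gauge k Λ z a) =
      x.gaugeUnitary z * x.pathRepresentation hrow a * star (x.gaugeUnitary z) := by
  let conj : (x.H →L[ℂ] x.H) →⋆ₙₐ[ℂ] (x.H →L[ℂ] x.H) :=
    ↑(Unitary.conjStarAlgAut ℂ (x.H →L[ℂ] x.H) (x.gaugeUnitary z))
  have heq : (x.pathRepresentation hrow).comp (gauge k Λ z) =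
      conj.comp (x.pathRepresentation hrow) := by
    refine (existsUnique_lift k Λ _ ((x.pathFamily hrow).twist z)).unique (fun _ _ f => ?_)
      fun _ _ f => ?_
    · exact map_smul (x.pathRepresentation hrow) (mFourier (zdeg k f) z) (gen k f)
    · change (x.gaugeUnitary z : x.H →L[ℂ] x.H) * x.pathOperator f * star (x.gaugeUnitary z) =
        mFourier (zdeg k f) z • x.pathOperator f
      rw [gaugeUnitary_mul_pathOperator, mul_assoc, Unitary.coe_mul_star_self, mul_one]
  exact DFunLike.congr_fun heq a

theorem pathRepresentation_gauge_eq_zero (hrow : IsRowFinite k Λ) (z : UnitAddTorus (Fin k))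
    {a : CStar k Λ} (ha : x.pathRepresentation hrow a = 0) :
    x.pathRepresentation hrow (gauge k Λ z a) = 0 := by
  rw [pathRepresentation_gauge, ha, mul_zero, zero_mul]

end InfinitePath

end PathRepresentations

end HigherRankGraph

end

theorem mainTheorem1 (k : ℕ) (hk : 1 ≤ k) (Λ : Type u) [SmallCategory Λ] [HigherRankGraph k Λ]
    (hrow : HigherRankGraph.IsRowFinite k Λ) (hsrc : HigherRankGraph.IsSourceFree k Λ) :
    (∃ y : Λ → HigherRankGraph.InfinitePath k Λ, ∀ v, (y v).range = v) ∧
    ∀ y : Λ → HigherRankGraph.InfinitePath k Λ, (∀ v, (y v).range = v) →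
      TopologicalSpace.SeparableSpace (HigherRankGraph.SumSpace y) ∧
      ∃ (πy : ∀ v, HigherRankGraph.CStar k Λ →⋆ₙₐ[ℂ] ((y v).H →L[ℂ] (y v).H))
        (π : HigherRankGraph.CStar k Λ →⋆ₙₐ[ℂ]
          (HigherRankGraph.SumSpace y →L[ℂ] HigherRankGraph.SumSpace y)),
        (∀ v, (y v).IsPathRepresentation (πy v)) ∧
        (∀ (a : HigherRankGraph.CStar k Λ) (h : HigherRankGraph.SumSpace y) (v : Λ),
          π a h v = πy v a (h v)) ∧
        Function.Injective π := by
  open HigherRankGraph in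
  open HigherRankGraph in
  refine ⟨Classical.skolem.1 (exists_infinitePath hsrc), fun y hy => ⟨?_, ?_⟩⟩
  · have := countable_obj k (Λ := Λ)
    have := fun v => (y v).countable_genClass
    have (v : Λ) : TopologicalSpace.SeparableSpace (y v).H := separableSpace_lp (by norm_num)
    exact separableSpace_lp (by norm_num)
  · refine ⟨fun v => (y v).pathRepresentation hrow, directSum _,
      fun v => (y v).isPathRepresentation_pathRepresentation hrow, fun a h v => rfl,
      gaugeInvariant_uniqueness hrow _ (fun v hv => ?_) fun z a ha => ?_⟩
    · have hne := (y v).pathRepresentation_range_ne_zero hrow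
      rw [hy v] at hne
      exact hne (directSum_eq_zero_iff.1 hv v)
    · exact directSum_eq_zero_iff.2 fun v =>
        (y v).pathRepresentation_gauge_eq_zero hrow z (directSum_eq_zero_iff.1 ha v)
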